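/- Rings are unital and ring homomorphisms preserve the unit. An integro-differential ring is a ring $A$ with a derivation $\partial$ and an additive map $\int\colon A\to A$ that is linear (on both sides) over the constants $\ker\partial$ and satisfies $\partial\int=\mathrm{id}$; homomorphisms of (integro-)differential rings are the ring homomorphisms that commute with $\partial$ (and $\int$). Let $(\mathcal R,\partial)$ be a commutative differential ring with ring of constants $\mathcal C=\ker\partial$, and let $\mathrm Q\colon\mathcal R\to\mathcal R$ be a quasi-integration, i.e. a $\mathcal C$-linear map with $\partial\mathrm Q\partial=\partial$ and $\mathrm Q\partial\mathrm Q=\mathrm Q$. Put $\mathcal R_{\mathrm J}=\mathrm Q\mathcal R$ and $\mathcal R_{\mathrm T}=\ker\mathrm Q$; all tensor products are over $\mathcal C$. Let $\mathcal T=\bigoplus_{n\ge0}\mathcal R_{\mathrm T}^{\otimes n}$, $\widetilde{\mathcal T}=\bigoplus_{n\ge1}\mathcal R_{\mathrm T}^{\otimes n}$, let $1_{\mathcal T}$ be the empty tensor and $\star$ the shuffle product on $\mathcal T$. For a pure tensor $f=f_1\otimes\dots\otimes f_n$ write $f_i^j=f_i\otimes\dots\otimes f_j$, with $f_{j+1}^{j}=1_{\mathcal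 T}$. Let $\mathcal C_1=\mathrm{Sym}(\varepsilon(M_1))$, where $\varepsilon(M_1)$ is a copy of $M_1=\mathcal R_{\mathrm J}\otimes\mathcal T$, and for $a\in\mathcal R_{\mathrm J}$ write $\varepsilon(a)=\varepsilon(a\otimes1_{\mathcal T})$. Let $\mathcal C_2=\mathrm{Sym}(\varepsilon(M_2))/J_2$, where $\varepsilon(M_2)$ is a copy of the symmetric square $M_2=\widetilde{\mathcal T}^{\odot2}$ and $J_2$ is the ideal generated by the elements $$\varepsilon((f\star g)\odot h)-\varepsilon(f\odot(g\star h))+\sum_{j=0}^{m-1}\Big(\sum_{i=\max(0,1-j)}^{n-1}\varepsilon(f_{i+1}^n\odot g_{j+1}^m)\,\varepsilon((f_1^i\star g_1^j)\odot h)-\sum_{k=\max(0,1-j)}^{l-1}\varepsilon(f\odot(g_1^j\star h_1^k))\,\varepsilon(g_{j+1}^m\odot h_{k+1}^l)\Big)$$ for all pure tensors $f,g,h$ over $\mathcal R_{\mathrm T}$ of lengths $n,m,l\ge1$. Give $\mathcal C_2\otimes\mathcal T$ the $\mathcal C$-bilinear product determined, for $c,d\in\mathcal C_2$ and pure tensors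 $f,g$ of lengths $n,m\ge0$, by $$(c\otimes f)\cdot(d\otimes g)=cd\otimes(f\star g)+\sum_{i=0}^{n-1}\sum_{j=0}^{m-1}cd\,\varepsilon(f_{i+1}^n\odot g_{j+1}^m)\otimes(f_1^i\star g_1^j).$$ Let $\mathrm{IDR}(\mathcal R)=\mathcal R\otimes\mathcal C_1\otimes(\mathcal C_2\otimes\mathcal T)$, with the product of the tensor product of algebras, and let $\iota(f)=f\otimes1\otimes1\otimes1_{\mathcal T}$ for $f\in\mathcal R$. Define $\mathcal C$-linear maps $\partial$ and $\int$ on $\mathrm{IDR}(\mathcal R)$, for $f_0\in\mathcal R$, $c=c_1\otimes c_2\in\mathcal C_1\otimes\mathcal C_2$ and pure tensors $f=f_1\otimes\dots\otimes f_n$ over $\mathcal R_{\mathrm T}$ with $n\ge1$, by $$\partial(f_0\otimes c\otimes1_{\mathcal T})=\partial f_0\otimes c\otimes1_{\mathcal T},\qquad \partial(f_0\otimes c\otimes f)=\partial f_0\otimes c\otimes f+f_0f_1\otimes c\otimes f_2^n,$$ $$\int(f_0\otimes c\otimes1_{\mathcal T})=\mathrm Qf_0\otimes c\otimes1_{\mathcal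 T}-1\otimes c_1\varepsilon(\mathrm Qf_0)\otimes c_2\otimes1_{\mathcal T}+1\otimes c\otimes(f_0-\partial\mathrm Qf_0),$$ $$\int(f_0\otimes c\otimes f)=\mathrm Qf_0\otimes c\otimes f-1\otimes c_1\varepsilon(\mathrm Qf_0\otimes f)\otimes c_2\otimes1_{\mathcal T}-\int\big((\mathrm Qf_0)f_1\otimes c\otimes f_2^n\big)+1\otimes c\otimes\big((f_0-\partial\mathrm Qf_0)\otimes f\big).$$ Then $(\mathrm{IDR}(\mathcal R),\partial,\int)$ is the free commutative integro-differential ring on $(\mathcal R,\partial)$, that is: 1. $(\mathrm{IDR}(\mathcal R),\partial,\int)$ is a commutative integro-differential ring; 2. $\iota\colon\mathcal R\to\mathrm{IDR}(\mathcal R)$ is an injective homomorphism of differential rings; 3. for every commutative integro-differential ring $(\mathcal S,\partial,\int)$ and every homomorphism of differential rings $\varphi\colon\mathcal R\to\mathcal S$ there is a unique homomorphism of integro-differential rings $\eta\colon\mathrm{IDR}(\mathcal R)\to\mathcal S$ with $\eta(\iota(f))=\varphi(f)$ for all $f\in\mathcal R$. -/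

import Mathlib

open scoped TensorProduct

noncomputable section

namespace IntegroDiff

/-! ## Differential rings, integrations, quasi-integrations -/

/-- The ring of constants `ker δ` of a commutative differential ring `(R, δ)`. -/
def constants {R : Type*} [CommRing R] (δ : Derivation ℤ R R) : Subring R where
  carrier := {c | δ c = 0}
  zero_mem' := map_zero δ
  one_mem' := δ.map_one_eq_zero
  add_mem' {a b} ha hb := by
    rw [Set.mem_ofPred_eq] at *
    rw [map_add, ha, hb, add_zero]
  neg_mem' {a} ha := by
    rw [Set.mem_ofPred_eq] at *
    rw [map_neg, ha, neg_zero]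
  mul_mem' {a b} ha hb := by
    rw [Set.mem_ofPred_eq] at *
    rw [δ.leibniz, ha, hb, smul_zero, smul_zero, add_zero]

/-- `d` is a derivation and `J` an integration with respect to `d` on the ring `A`: `d ∘ J = id`
and `J` is linear over the constants of `d`, on both sides. (This is phrased without associativity,
so that it makes sense on a ring whose associativity is still to be proved.) -/
structure IsIntegroDifferential {A : Type*} [NonAssocRing A] (d J : A → A) : Prop where
  deriv_add : ∀ f g, d (f + g) = d f + d g
  deriv_mul : ∀ f g, d (f * g) = d f * g + f * d g
  int_add : ∀ f g, J (f + g) = J f + J g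
  int_const_mul : ∀ c f, d c = 0 → J (c * f) = c * J f
  int_mul_const : ∀ c f, d c = 0 → J (f * c) = J f * c
  deriv_int : ∀ f, d (J f) = f

/-- A quasi-integration on a commutative differential ring `(R, δ)`. -/
structure QuasiIntegration {R : Type*} [CommRing R] (δ : Derivation ℤ R R) where
  toLinearMap : R →ₗ[constants δ] R
  deriv_comp_deriv : ∀ f, δ (toLinearMap (δ f)) = δ f
  comp_deriv_comp : ∀ f, toLinearMap (δ (toLinearMap f)) = toLinearMap f

/-! ## The module of words `T(M)` and its shuffle product -/

section Words

variable (C : Type*) [CommRing C] (M : Type*) [AddCommGroup M] [Module C M]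

/-- The tensor algebra `T(M)`; its multiplication is the tensor (concatenation) product. -/
abbrev T : Type _ := TensorAlgebra C M

variable {M}

/-- The pure tensor `f₁ ⊗ ⋯ ⊗ fₙ ∈ T(M)` of a list `f = [f₁, …, fₙ]`. -/
def word (l : List M) : T C M := (l.map (TensorAlgebra.ι C)).prod

@[simp] theorem word_nil : word C ([] : List M) = 1 := rfl

@[simp] theorem word_cons (m : M) (l : List M) :
    word C (m :: l) = TensorAlgebra.ι C m * word C l := by
  simp [word]

variable {C}

/-- Structural recursion on the first letter: the linear map `F` on `T(M)` with
`F 1 = x₀` and `F (m ⊗ t) = a m t + b m (F t)`. -/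
def wordRec {X : Type*} [AddCommGroup X] [Module C X] (x₀ : X) (a : M →ₗ[C] T C M →ₗ[C] X)
    (b : M →ₗ[C] X →ₗ[C] X) : T C M →ₗ[C] X :=
  LinearMap.snd C (T C M) X ∘ₗ LinearMap.applyₗ ((1 : T C M), x₀) ∘ₗ
    (TensorAlgebra.lift C (A := Module.End C (T C M × X))
      { toFun := fun m =>
          LinearMap.prod (LinearMap.mulLeft C (TensorAlgebra.ι C m) ∘ₗ LinearMap.fst C (T C M) X)
            (LinearMap.coprod (a m) (b m))
        map_add' := fun m n => by ext <;> simp [add_mul]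
        map_smul' := fun c m => by ext <;> simp }).toLinearMap

theorem fst_lift_apply {X : Type*} [AddCommGroup X] [Module C X]
    (L : M →ₗ[C] Module.End C (T C M × X))
    (hL : ∀ m p, (L m p).1 = TensorAlgebra.ι C m * p.1) (t : T C M) (p : T C M × X) :
    ((TensorAlgebra.lift C L t) p).1 = t * p.1 := by
  induction t using TensorAlgebra.induction generalizing p with
  | algebraMap r => simp [Algebra.smul_def]
  | ι m => simp [hL]
  | mul s t hs ht => simp [hs, ht, mul_assoc]
  | add s t hs ht => simp [hs, ht, add_mul]

@[simp] theorem wordRec_one {X : Type*} [AddCommGroup X] [Module C X] (x₀ : X)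
    (a : M →ₗ[C] T C M →ₗ[C] X) (b : M →ₗ[C] X →ₗ[C] X) : wordRec x₀ a b 1 = x₀ := by
  simp [wordRec]

@[simp] theorem wordRec_ι_mul {X : Type*} [AddCommGroup X] [Module C X] (x₀ : X)
    (a : M →ₗ[C] T C M →ₗ[C] X) (b : M →ₗ[C] X →ₗ[C] X) (m : M) (t : T C M) :
    wordRec x₀ a b (TensorAlgebra.ι C m * t) = a m t + b m (wordRec x₀ a b t) := by
  have h := fst_lift_apply
    { toFun := fun m =>
          LinearMap.prod (LinearMap.mulLeft C (TensorAlgebra.ι C m) ∘ₗ LinearMap.fst C (T C M) X)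
            (LinearMap.coprod (a m) (b m))
      map_add' := fun m n => by ext <;> simp [add_mul]
      map_smul' := fun c m => by ext <;> simp } (fun m p => by simp) t (1, x₀)
  simp only [wordRec, LinearMap.comp_apply, AlgHom.toLinearMap_apply, map_mul,
    TensorAlgebra.lift_ι_apply, LinearMap.applyₗ_apply_apply, Module.End.mul_apply]
  simp at h ⊢
  rw [h]

/-- Left multiplication by letters, `m ↦ (t ↦ m ⊗ t)`. -/
def cons : M →ₗ[C] T C M →ₗ[C] T C M :=
  LinearMap.mul C (T C M) ∘ₗ TensorAlgebra.ι C

@[simp] theorem cons_apply (m : M) (t : T C M) : cons m t = TensorAlgebra.ι C m * t := rfl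

/-- Deconcatenation `f₁ ⊗ ⋯ ⊗ fₙ ↦ ∑_{0 ≤ i ≤ n} f₁^i ⊗ f_{i+1}^n`, see `decon_word`. -/
def decon : T C M →ₗ[C] T C M ⊗[C] T C M :=
  wordRec (1 ⊗ₜ 1) (cons.compr₂ (TensorProduct.mk C (T C M) (T C M) 1))
    (LinearMap.rTensorHom (T C M) ∘ₗ cons)

@[simp] theorem decon_one : decon (1 : T C M) = 1 ⊗ₜ 1 := by simp [decon]

@[simp] theorem decon_ι_mul (m : M) (t : T C M) :
    decon (TensorAlgebra.ι C m * t) =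
      1 ⊗ₜ (TensorAlgebra.ι C m * t) + (cons m).rTensor (T C M) (decon t) := by
  simp [decon]

theorem decon_word (l : List M) :
    decon (word C l) =
      ∑ i ∈ Finset.range (l.length + 1), word C (l.take i) ⊗ₜ[C] word C (l.drop i) := by
  induction l with
  | nil => simp
  | cons m l ih =>
    rw [word_cons, decon_ι_mul, ih, List.length_cons, Finset.sum_range_succ' _ (l.length + 1)]
    simp only [map_sum, LinearMap.rTensor_tmul, cons_apply, List.take_succ_cons,
      List.drop_succ_cons, word_cons, List.take_zero, List.drop_zero, word_nil]
    rw [add_comm]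

/-- The shuffle product on `T(M)`. It is given by the rule that the first letter of `m ⊗ t` is
preceded in the shuffle with `s` by some prefix of `s`:
`(m ⊗ t) ⧢ s = ∑ s' ⊗ m ⊗ (t ⧢ s'')`, the sum running over the deconcatenation of `s`.
The usual recursion holds: see `shuffle_one_left`, `shuffle_one_right` and `shuffle_ι_mul_ι_mul`. -/
def shuffle : T C M →ₗ[C] T C M →ₗ[C] T C M :=
  wordRec LinearMap.id 0
    (LinearMap.mk₂ C
      (fun (m : M) (x : T C M →ₗ[C] T C M) =>
        LinearMap.mul' C (T C M) ∘ₗ (cons m ∘ₗ x).lTensor (T C M) ∘ₗ decon)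
      (fun m n x => by
        rw [map_add, LinearMap.add_comp, LinearMap.lTensor_add, LinearMap.add_comp,
          LinearMap.comp_add])
      (fun c m x => by
        rw [map_smul, LinearMap.smul_comp, LinearMap.lTensor_smul, LinearMap.smul_comp,
          LinearMap.comp_smul])
      (fun m x y => by
        rw [LinearMap.comp_add, LinearMap.lTensor_add, LinearMap.add_comp, LinearMap.comp_add])
      (fun c m x => by
        rw [LinearMap.comp_smul, LinearMap.lTensor_smul, LinearMap.smul_comp,
          LinearMap.comp_smul]))

@[simp] theorem shuffle_one_left (t : T C M) : shuffle 1 t = t := by simp [shuffle]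

theorem shuffle_ι_mul (m : M) (s t : T C M) :
    shuffle (TensorAlgebra.ι C m * s) t =
      LinearMap.mul' C (T C M) ((cons m ∘ₗ shuffle s).lTensor (T C M) (decon t)) := by
  simp [shuffle]

/-- Induction on the first letter. -/
theorem word_induction {p : T C M → Prop} (one : p 1) (add : ∀ s t, p s → p t → p (s + t))
    (smul : ∀ (c : C) t, p t → p (c • t)) (cons : ∀ m t, p t → p (TensorAlgebra.ι C m * t))
    (t : T C M) : p t := by
  suffices h : ∀ s, p s → p (t * s) by simpa using h 1 one
  induction t using TensorAlgebra.induction with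
  | algebraMap r => intro s hs; simpa [← Algebra.smul_def] using smul r s hs
  | ι m => exact fun s hs => cons m s hs
  | mul a b ha hb => intro s hs; rw [mul_assoc]; exact ha _ (hb s hs)
  | add a b ha hb => intro s hs; rw [add_mul]; exact add _ _ (ha s hs) (hb s hs)

@[simp] theorem shuffle_one_right (t : T C M) : shuffle t 1 = t := by
  induction t using word_induction with
  | one => simp
  | add s t hs ht => simp [hs, ht]
  | smul c t ht => simp [ht]
  | cons m t ht => simp [shuffle_ι_mul, ht]

theorem shuffle_ι_mul_ι_mul (m n : M) (s t : T C M) :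
    shuffle (TensorAlgebra.ι C m * s) (TensorAlgebra.ι C n * t) =
      TensorAlgebra.ι C m * shuffle s (TensorAlgebra.ι C n * t) +
      TensorAlgebra.ι C n * shuffle (TensorAlgebra.ι C m * s) t := by
  rw [shuffle_ι_mul, decon_ι_mul, map_add, map_add, shuffle_ι_mul]
  congr 1
  · simp
  · generalize decon t = d
    induction d using TensorProduct.induction_on with
    | zero => simp
    | tmul a b => simp [mul_assoc]
    | add a b ha hb => simp only [map_add, mul_add, ha, hb]

/-! ## The algebra of evaluations `C₂` and the algebra `C₂ ⊗ T(M)` -/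

variable (C M) in
/-- The submodule `⨁_{n ≥ 1} M^{⊗ n}` of `T(M)`, as the augmentation ideal. -/
def tildeSubmodule : Submodule C (T C M) :=
  LinearMap.ker (TensorAlgebra.algebraMapInv (R := C) (M := M)).toLinearMap

theorem tildeSubmodule_eq_span :
    tildeSubmodule C M = Submodule.span C {t | ∃ l : List M, l ≠ [] ∧ t = word C l} := by
  apply le_antisymm
  · intro t ht
    suffices h : ∀ t : T C M, t - algebraMap C _ (TensorAlgebra.algebraMapInv t) ∈
        Submodule.span C {t | ∃ l : List M, l ≠ [] ∧ t = word C l} by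
      have h0 : TensorAlgebra.algebraMapInv t = 0 := ht
      simpa [h0] using h t
    intro t
    suffices h : t ∈ Submodule.span C (Set.range (word C (M := M))) by
      induction h using Submodule.span_induction with
      | mem t ht =>
        obtain ⟨l, rfl⟩ := ht
        cases l with
        | nil => simp
        | cons m l =>
          refine Submodule.subset_span ⟨m :: l, by simp, ?_⟩
          simp [TensorAlgebra.algebraMapInv]
      | zero => simp
      | add a b _ _ ha hb =>
        rw [map_add, map_add, add_sub_add_comm]; exact add_mem ha hb
      | smul c a _ ha =>
        have := Submodule.smul_mem _ c ha
        rw [smul_sub] at this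
        rw [map_smul, Algebra.smul_def c (TensorAlgebra.algebraMapInv a), map_mul,
          Algebra.algebraMap_self_apply, ← Algebra.smul_def]
        exact this
    induction t using word_induction with
    | one => exact Submodule.subset_span ⟨[], rfl⟩
    | add s t hs ht => exact add_mem hs ht
    | smul c t ht => exact Submodule.smul_mem _ c ht
    | cons m t ht =>
      have : Submodule.span C (Set.range (word C (M := M))) ≤
          (Submodule.span C (Set.range (word C (M := M)))).comap (cons m) := by
        rw [Submodule.span_le]
        rintro _ ⟨l, rfl⟩
        exact Submodule.subset_span ⟨m :: l, by simp⟩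
      exact this ht
  · rw [Submodule.span_le]
    rintro _ ⟨l, hl, rfl⟩
    obtain ⟨m, l, rfl⟩ := List.exists_cons_of_ne_nil hl
    simp [tildeSubmodule, TensorAlgebra.algebraMapInv]

variable (C M) in
/-- `⨁_{n ≥ 1} M^{⊗ n}` as a type. -/
def Ttilde : Type _ := tildeSubmodule C M

instance : AddCommGroup (Ttilde C M) := inferInstanceAs (AddCommGroup (tildeSubmodule C M))
instance : Module C (Ttilde C M) := inferInstanceAs (Module C (tildeSubmodule C M))

/-- The projection of `T(M)` onto `⨁_{n ≥ 1} M^{⊗ n}`, which drops the component of degree `0`. -/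
def tildeProj : T C M →ₗ[C] Ttilde C M :=
  (LinearMap.id - Algebra.linearMap C (T C M) ∘ₗ
    (TensorAlgebra.algebraMapInv (R := C) (M := M)).toLinearMap).codRestrict (tildeSubmodule C M)
    fun t => by simp [tildeSubmodule]

theorem subtype_tildeProj (t : T C M) : (tildeSubmodule C M).subtype (tildeProj t) =
    t - algebraMap C (T C M) (TensorAlgebra.algebraMapInv t) := rfl

theorem tildeProj_word_cons (m : M) (l : List M) :
    (tildeSubmodule C M).subtype (tildeProj (word C (m :: l))) = word C (m :: l) := by
  simp [subtype_tildeProj, TensorAlgebra.algebraMapInv]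

theorem tildeProj_one : tildeProj (1 : T C M) = 0 :=
  (tildeSubmodule C M).injective_subtype
    ((subtype_tildeProj 1).trans ((by simp : _ = (0 : T C M)).trans (map_zero _).symm))

variable (C M) in
/-- `M₂`, the symmetric square of `⨁_{n ≥ 1} M^{⊗ n}`. -/
def M₂ : Type _ :=
  (Ttilde C M ⊗[C] Ttilde C M) ⧸ Submodule.span C
    {x : Ttilde C M ⊗[C] Ttilde C M | ∃ f g, x = f ⊗ₜ g - g ⊗ₜ f}

instance : AddCommGroup (M₂ C M) := inferInstanceAs (AddCommGroup (_ ⧸ Submodule.span C _))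
instance : Module C (M₂ C M) := inferInstanceAs (Module C (_ ⧸ Submodule.span C _))

variable (C M) in
/-- The canonical map from the tensor square to the symmetric square. -/
def M₂.mk : Ttilde C M ⊗[C] Ttilde C M →ₗ[C] M₂ C M := Submodule.mkQ _

/-- `(f, g) ↦ ε(f ⊙ g) ∈ Sym(ε(M₂))`, extended by `0` when `f` or `g` is of degree `0`. -/
def preEps₂ : T C M →ₗ[C] T C M →ₗ[C] SymmetricAlgebra C (M₂ C M) :=
  ((TensorProduct.mk C _ _).compl₁₂ tildeProj tildeProj).compr₂
    (SymmetricAlgebra.ι C (M₂ C M) ∘ₗ M₂.mk C M)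

/-- The relation among evaluations attached to three pure tensors; `f.take i` is `f₁^i` and
`f.drop i` is `f_{i+1}^n`. Note that `1 - j = max (0, 1 - j)` in `ℕ`. -/
def evalRel (f g h : List M) : SymmetricAlgebra C (M₂ C M) :=
  preEps₂ (shuffle (word C f) (word C g)) (word C h)
    - preEps₂ (word C f) (shuffle (word C g) (word C h))
    + ∑ j ∈ Finset.range g.length,
      (∑ i ∈ Finset.Ico (1 - j) f.length,
          preEps₂ (word C (f.drop i)) (word C (g.drop j)) *
            preEps₂ (shuffle (word C (f.take i)) (word C (g.take j))) (word C h)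
        - ∑ k ∈ Finset.Ico (1 - j) h.length,
          preEps₂ (word C f) (shuffle (word C (g.take j)) (word C (h.take k))) *
            preEps₂ (word C (g.drop j)) (word C (h.drop k)))

variable (C M) in
/-- The ideal of `Sym(ε(M₂))` generated by the relations of all triples of pure tensors of
positive length. -/
def J₂ : Ideal (SymmetricAlgebra C (M₂ C M)) :=
  Ideal.span {x | ∃ f g h : List M, f ≠ [] ∧ g ≠ [] ∧ h ≠ [] ∧ x = evalRel f g h}

variable (C M) in
/-- The algebra `C₂ = Sym(ε(M₂)) / J₂`. -/
def C₂ : Type _ := SymmetricAlgebra C (M₂ C M) ⧸ J₂ C M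

instance : CommRing (C₂ C M) := inferInstanceAs (CommRing (SymmetricAlgebra C (M₂ C M) ⧸ J₂ C M))
instance : Algebra C (C₂ C M) :=
  inferInstanceAs (Algebra C (SymmetricAlgebra C (M₂ C M) ⧸ J₂ C M))

variable (C M) in
/-- The canonical projection `Sym(ε(M₂)) → C₂`. -/
def C₂.proj : SymmetricAlgebra C (M₂ C M) →ₐ[C] C₂ C M := Ideal.Quotient.mkₐ C (J₂ C M)

/-- `(f, g) ↦ ε(f ⊙ g) ∈ C₂`, extended by `0` when `f` or `g` is of degree `0`. -/
def eps₂ : T C M →ₗ[C] T C M →ₗ[C] C₂ C M :=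
  preEps₂.compr₂ (C₂.proj C M).toLinearMap

variable (C M) in
/-- The module `C₂ ⊗ T(M)`; a type synonym, because its product is not the product of the tensor
product of the algebras `C₂` and `T(M)`. -/
def C₂T : Type _ := C₂ C M ⊗[C] T C M

namespace C₂T

instance : AddCommGroup (C₂T C M) := inferInstanceAs (AddCommGroup (C₂ C M ⊗[C] T C M))
instance : Module C (C₂T C M) := inferInstanceAs (Module C (C₂ C M ⊗[C] T C M))

/-- `(c, f) ↦ c ⊗ f`. -/
def mk : C₂ C M →ₗ[C] T C M →ₗ[C] C₂T C M := TensorProduct.mk C (C₂ C M) (T C M)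

variable (C M) in
/-- The product `(1 ⊗ f) · (1 ⊗ g) = 1 ⊗ (f ⧢ g) + ∑ ε(f'' ⊙ g'') ⊗ (f' ⧢ g')`, the sum running over
the deconcatenations of `f` and `g` with non-empty `f''` and `g''`. -/
def mulT : T C M →ₗ[C] T C M →ₗ[C] C₂ C M ⊗[C] T C M :=
  shuffle.compr₂ (TensorProduct.mk C (C₂ C M) (T C M) 1) +
    ((TensorProduct.map₂ shuffle eps₂).compl₁₂ decon decon).compr₂
      (TensorProduct.comm C (T C M) (C₂ C M)).toLinearMap

variable (C M) in
/-- The bilinear product of `C₂ ⊗ T(M)`, `(c ⊗ f) · (d ⊗ g) = (c d) · ((1 ⊗ f) · (1 ⊗ g))`; on pure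
tensors it is spelled out in `mk_word_mul_mk_word`. -/
def mulMap : C₂T C M →ₗ[C] C₂T C M →ₗ[C] C₂T C M :=
  (TensorProduct.map₂ (LinearMap.mul C (C₂ C M)) (mulT C M)).compr₂
    ((LinearMap.mul' C (C₂ C M)).rTensor (T C M) ∘ₗ
      (TensorProduct.assoc C (C₂ C M) (C₂ C M) (T C M)).symm.toLinearMap)

theorem eps₂_one_left (g : T C M) : eps₂ 1 g = 0 := by
  simp [eps₂, preEps₂, tildeProj_one]

theorem eps₂_one_right (f : T C M) : eps₂ f 1 = 0 := by
  simp [eps₂, preEps₂, tildeProj_one]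

theorem mulMap_mk_mk (c d : C₂ C M) (f g : T C M) :
    mulMap C M (mk c f) (mk d g) = (LinearMap.mulLeft C (c * d)).rTensor (T C M) (mulT C M f g) := by
  change (LinearMap.mul' C (C₂ C M)).rTensor (T C M)
    ((TensorProduct.assoc C (C₂ C M) (C₂ C M) (T C M)).symm ((c * d) ⊗ₜ mulT C M f g)) = _
  generalize mulT C M f g = x
  induction x using TensorProduct.induction_on with
  | zero => simp
  | tmul a b => simp [mul_assoc]
  | add a b ha hb => simp only [TensorProduct.tmul_add, map_add, ha, hb]

theorem mulT_one_left (g : T C M) : mulT C M 1 g = (1 : C₂ C M) ⊗ₜ[C] g := by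
  have h : ∀ x : T C M ⊗[C] T C M,
      TensorProduct.map₂ shuffle eps₂ ((1 : T C M) ⊗ₜ[C] (1 : T C M)) x = 0 := fun x => by
    induction x using TensorProduct.induction_on with
    | zero => simp
    | tmul a b => simp [eps₂_one_left]
    | add a b ha hb => simp only [map_add, ha, hb, add_zero]
  simp only [mulT, LinearMap.add_apply, LinearMap.compr₂_apply, LinearMap.compl₁₂_apply,
    decon_one, h, shuffle_one_left, map_zero, add_zero, TensorProduct.mk_apply]

theorem mulT_one_right (f : T C M) : mulT C M f 1 = (1 : C₂ C M) ⊗ₜ[C] f := by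
  have h : ∀ x : T C M ⊗[C] T C M,
      TensorProduct.map₂ shuffle eps₂ x ((1 : T C M) ⊗ₜ[C] (1 : T C M)) = 0 := fun x => by
    induction x using TensorProduct.induction_on with
    | zero => simp
    | tmul a b => simp [eps₂_one_right]
    | add a b ha hb => simp only [map_add, LinearMap.add_apply, ha, hb, add_zero]
  simp only [mulT, LinearMap.add_apply, LinearMap.compr₂_apply, LinearMap.compl₁₂_apply,
    decon_one, h, shuffle_one_right, map_zero, add_zero, TensorProduct.mk_apply]

theorem induction_on {p : C₂T C M → Prop} (x : C₂T C M) (zero : p 0)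
    (mk : ∀ c f, p (mk c f)) (add : ∀ x y, p x → p y → p (x + y)) : p x :=
  TensorProduct.induction_on (motive := p) x zero mk add

instance : NonAssocRing (C₂T C M) where
  __ := (inferInstance : AddCommGroup (C₂T C M))
  mul x y := mulMap C M x y
  one := mk 1 1
  left_distrib x y z := map_add (mulMap C M x) y z
  right_distrib x y z := LinearMap.map_add₂ (mulMap C M) x y z
  zero_mul x := LinearMap.map_zero₂ (mulMap C M) x
  mul_zero x := map_zero (mulMap C M x)
  one_mul x := by
    change mulMap C M (mk 1 1) x = x
    induction x using induction_on with
    | zero => exact map_zero _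
    | mk c f => rw [mulMap_mk_mk, mulT_one_left, one_mul]; simp; rfl
    | add x y hx hy => rw [map_add, hx, hy]
  mul_one x := by
    change mulMap C M x (mk 1 1) = x
    induction x using induction_on with
    | zero => exact LinearMap.map_zero₂ _ _
    | mk c f => rw [mulMap_mk_mk, mulT_one_right, mul_one]; simp; rfl
    | add x y hx hy => rw [LinearMap.map_add₂, hx, hy]

theorem mul_def (x y : C₂T C M) : x * y = mulMap C M x y := rfl

theorem one_def : (1 : C₂T C M) = mk 1 1 := rfl

instance : IsScalarTower C (C₂T C M) (C₂T C M) :=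
  ⟨fun c x y => LinearMap.map_smul₂ (mulMap C M) c x y⟩

instance : SMulCommClass C (C₂T C M) (C₂T C M) :=
  ⟨fun c x y => ((mulMap C M x).map_smul c y).symm⟩

/-- The product of `C₂ ⊗ T(M)` on pure tensors; `f.take i` is `f₁^i` and `f.drop i` is
`f_{i+1}^n`. -/
theorem mk_word_mul_mk_word (c d : C₂ C M) (f g : List M) :
    mk c (word C f) * mk d (word C g) = mk (c * d) (shuffle (word C f) (word C g)) +
      ∑ i ∈ Finset.range f.length, ∑ j ∈ Finset.range g.length,
        mk (c * d * eps₂ (word C (f.drop i)) (word C (g.drop j)))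
          (shuffle (word C (f.take i)) (word C (g.take j))) := by
  rw [mul_def, mulMap_mk_mk]
  simp only [mulT, LinearMap.add_apply, LinearMap.compr₂_apply, LinearMap.compl₁₂_apply,
    decon_word, map_sum, LinearMap.sum_apply, TensorProduct.map₂_apply_tmul,
    TensorProduct.map_tmul, map_add, TensorProduct.mk_apply, LinearMap.rTensor_tmul,
    LinearEquiv.coe_coe, TensorProduct.comm_tmul, LinearMap.mulLeft_apply, mul_one]
  refine congrArg _ ?_
  rw [Finset.sum_range_succ]
  simp only [Finset.sum_range_succ, List.drop_length, word_nil, eps₂_one_left, eps₂_one_right,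
    mul_zero, TensorProduct.zero_tmul, add_zero, Finset.sum_const_zero]
  exact Finset.sum_comm

end C₂T
end Words

/-! ## The integro-differential ring `IDR(R)` -/

section IDR

variable {R : Type*} [CommRing R] {δ : Derivation ℤ R R} (Q : QuasiIntegration δ)

/-- `R_J = Q R`. -/
abbrev RJ : Submodule (constants δ) R := LinearMap.range Q.toLinearMap

/-- `R_T = ker Q`. -/
abbrev RT : Submodule (constants δ) R := LinearMap.ker Q.toLinearMap

/-- The words `T(R_T)`. -/
abbrev W : Type _ := T (constants δ) (RT Q)

/-- `C₁ = Sym(ε(M₁))` with `M₁ = R_J ⊗ T(R_T)`. -/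
def C₁ : Type _ := SymmetricAlgebra (constants δ) (RJ Q ⊗[constants δ] W Q)

instance : CommRing (C₁ Q) :=
  inferInstanceAs (CommRing (SymmetricAlgebra (constants δ) (RJ Q ⊗[constants δ] W Q)))
instance : Algebra (constants δ) (C₁ Q) :=
  inferInstanceAs (Algebra (constants δ) (SymmetricAlgebra (constants δ) (RJ Q ⊗[constants δ] W Q)))

/-- `(f₀, f) ↦ ε(f₀ ⊗ f) ∈ C₁`. -/
def eps₁ : RJ Q →ₗ[constants δ] W Q →ₗ[constants δ] C₁ Q :=
  (TensorProduct.mk (constants δ) (RJ Q) (W Q)).compr₂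
    (SymmetricAlgebra.ι (constants δ) (RJ Q ⊗[constants δ] W Q))

/-- The algebra `C₁ ⊗ C₂`, where `C₂` is built from the module `R_T`. -/
abbrev C₁₂ : Type _ := C₁ Q ⊗[constants δ] C₂ (constants δ) (RT Q)

/-- `IDR(R) = R ⊗ C₁ ⊗ (C₂ ⊗ T(R_T))`, with the product of the tensor product of the algebras `R`,
`C₁` and `C₂ ⊗ T(R_T)`. -/
def IDR : Type _ := R ⊗[constants δ] (C₁ Q ⊗[constants δ] C₂T (constants δ) (RT Q))

/-- `Q` as a map `R → R_J`. -/
def QuasiIntegration.toRJ : R →ₗ[constants δ] RJ Q := Q.toLinearMap.rangeRestrict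

/-- The projection `f ↦ f - δ (Q f)` of `R` onto `R_T`. -/
def QuasiIntegration.toRT : R →ₗ[constants δ] RT Q where
  toFun f := ⟨f - δ (Q.toLinearMap f), by
    rw [LinearMap.mem_ker, map_sub, Q.comp_deriv_comp, sub_self]⟩
  map_add' f g := Subtype.ext (by simp [add_sub_add_comm])
  map_smul' c f := Subtype.ext (by
    have h : δ (c : R) = 0 := c.2
    change c • f - δ (Q.toLinearMap (c • f)) = c • (f - δ (Q.toLinearMap f))
    rw [map_smul]
    simp [Subring.smul_def, h, mul_sub])

/-- `δ` as a linear map over the constants. -/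
def derivLin (δ : Derivation ℤ R R) : R →ₗ[constants δ] R where
  toFun := δ
  map_add' := map_add δ
  map_smul' c f := by
    have h : δ (c : R) = 0 := c.2
    simp [Subring.smul_def, h]

namespace IDR

instance : NonAssocRing (IDR Q) where
  __ := (inferInstanceAs
    (NonAssocSemiring (R ⊗[constants δ] (C₁ Q ⊗[constants δ] C₂T (constants δ) (RT Q)))) :
      NonAssocSemiring (IDR Q))
  __ := (inferInstanceAs
    (AddCommGroup (R ⊗[constants δ] (C₁ Q ⊗[constants δ] C₂T (constants δ) (RT Q)))) :
      AddCommGroup (IDR Q))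

instance : Module (constants δ) (IDR Q) := inferInstanceAs
  (Module (constants δ) (R ⊗[constants δ] (C₁ Q ⊗[constants δ] C₂T (constants δ) (RT Q))))

/-- The canonical map `R ⊗ ((C₁ ⊗ C₂) ⊗ T(R_T)) ≃ R ⊗ (C₁ ⊗ (C₂ ⊗ T(R_T))) = IDR(R)`. -/
def assocEquiv : R ⊗[constants δ] (C₁₂ Q ⊗[constants δ] W Q) ≃ₗ[constants δ] IDR Q :=
  (TensorProduct.assoc (constants δ) (C₁ Q) (C₂ (constants δ) (RT Q)) (W Q)).lTensor R

/-- `(f₀, c, f) ↦ f₀ ⊗ c ⊗ f`, where `c ∈ C₁ ⊗ C₂`. -/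
def tmul : R →ₗ[constants δ] C₁₂ Q →ₗ[constants δ] W Q →ₗ[constants δ] IDR Q :=
  LinearMap.mk₂ (constants δ)
    (fun f₀ c => (assocEquiv Q).toLinearMap ∘ₗ TensorProduct.mk (constants δ) R _ f₀ ∘ₗ
      TensorProduct.mk (constants δ) _ _ c)
    (fun a b c => by simp only [map_add, LinearMap.add_comp, LinearMap.comp_add])
    (fun r a c => by simp only [map_smul, LinearMap.smul_comp, LinearMap.comp_smul])
    (fun a b c => by simp only [map_add, LinearMap.comp_add])
    (fun r a c => by simp only [map_smul, LinearMap.comp_smul])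

theorem tmul_tmul (f₀ : R) (c₁ : C₁ Q) (c₂ : C₂ (constants δ) (RT Q)) (f : W Q) :
    tmul Q f₀ (c₁ ⊗ₜ c₂) f = f₀ ⊗ₜ[constants δ] (c₁ ⊗ₜ[constants δ] C₂T.mk c₂ f) := rfl

/-- The product of `IDR(R)`. -/
theorem tmul_mul_tmul (f₀ g₀ : R) (c₁ d₁ : C₁ Q) (c₂ d₂ : C₂ (constants δ) (RT Q)) (f g : W Q) :
    tmul Q f₀ (c₁ ⊗ₜ c₂) f * tmul Q g₀ (d₁ ⊗ₜ d₂) g =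
      (f₀ * g₀) ⊗ₜ[constants δ] ((c₁ * d₁) ⊗ₜ[constants δ] (C₂T.mk c₂ f * C₂T.mk d₂ g)) :=
  (Algebra.TensorProduct.tmul_mul_tmul (R := constants δ) f₀ g₀
    (c₁ ⊗ₜ[constants δ] C₂T.mk c₂ f) (d₁ ⊗ₜ[constants δ] C₂T.mk d₂ g)).trans
      (congrArg _ (Algebra.TensorProduct.tmul_mul_tmul _ _ _ _))

/-- `tmul` with the arguments in the order `(f, f₀, c)`. -/
def tmul' : W Q →ₗ[constants δ] R →ₗ[constants δ] C₁₂ Q →ₗ[constants δ] IDR Q :=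
  (LinearMap.lflip.toLinearMap ∘ₗ tmul Q).flip

@[simp] theorem tmul'_apply (f : W Q) (f₀ : R) (c : C₁₂ Q) : tmul' Q f f₀ c = tmul Q f₀ c f := rfl

variable {Q} in
/-- The linear map on `IDR(R)` with `f₀ ⊗ c ⊗ f ↦ F f f₀ c`. -/
def lift {N : Type*} [AddCommGroup N] [Module (constants δ) N]
    (F : W Q →ₗ[constants δ] R →ₗ[constants δ] C₁₂ Q →ₗ[constants δ] N) :
    IDR Q →ₗ[constants δ] N :=
  TensorProduct.lift (TensorProduct.uncurry (.id _) _ _ _ ∘ₗ LinearMap.lflip.toLinearMap ∘ₗ F.flip)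
    ∘ₗ (assocEquiv Q).symm.toLinearMap

@[simp] theorem lift_tmul {N : Type*} [AddCommGroup N] [Module (constants δ) N]
    (F : W Q →ₗ[constants δ] R →ₗ[constants δ] C₁₂ Q →ₗ[constants δ] N) (f₀ : R) (c : C₁₂ Q)
    (f : W Q) : lift F (tmul Q f₀ c f) = F f f₀ c := by
  simp [lift, tmul]

/-- The map `ι : R → IDR(R)`, `f ↦ f ⊗ 1 ⊗ 1 ⊗ 1`. -/
def ι : R →+* IDR Q where
  toFun f := tmul Q f 1 1
  map_one' := rfl
  map_zero' := by simp
  map_add' f g := by simp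
  map_mul' f g := by
    have h := (Algebra.TensorProduct.tmul_mul_tmul (R := constants δ) f g
      (1 : C₁ Q ⊗[constants δ] C₂T (constants δ) (RT Q)) 1).symm
    rw [one_mul] at h
    exact h

/-- The derivation of `IDR(R)`, see `deriv_tmul_one` and `deriv_tmul_ι_mul`. -/
def deriv : IDR Q →ₗ[constants δ] IDR Q :=
  lift ((tmul' Q).compl₂ (derivLin δ) + wordRec 0
    (LinearMap.mk₂ (constants δ)
      (fun m t => tmul' Q t ∘ₗ LinearMap.mulRight (constants δ) (m : R))
      (fun a b t => by ext; simp [mul_add]) (fun r a t => by ext; simp)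
      (fun a s t => by ext; simp) (fun r a t => by ext; simp)) 0)

/-- `∂(f₀ ⊗ c ⊗ 1) = (∂ f₀) ⊗ c ⊗ 1`. -/
theorem deriv_tmul_one (f₀ : R) (c : C₁₂ Q) :
    deriv Q (tmul Q f₀ c 1) = tmul Q (δ f₀) c 1 := by
  simp [deriv, derivLin]

/-- `∂(f₀ ⊗ c ⊗ f) = (∂ f₀) ⊗ c ⊗ f + (f₀ f₁) ⊗ c ⊗ t` for `f = f₁ ⊗ t`. -/
theorem deriv_tmul_ι_mul (f₀ : R) (c : C₁₂ Q) (f₁ : RT Q) (t : W Q) :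
    deriv Q (tmul Q f₀ c (TensorAlgebra.ι _ f₁ * t)) =
      tmul Q (δ f₀) c (TensorAlgebra.ι _ f₁ * t) + tmul Q (f₀ * f₁) c t := by
  simp [deriv, derivLin]

/-- `(f₀, f) ↦ ε(f₀ ⊗ f) ⊗ 1 ∈ C₁ ⊗ C₂`. -/
def eps₁₂ : RJ Q →ₗ[constants δ] W Q →ₗ[constants δ] C₁₂ Q :=
  (eps₁ Q).compr₂ ((TensorProduct.mk (constants δ) (C₁ Q) (C₂ (constants δ) (RT Q))).flip 1)

/-- The non-recursive part of the integral:
`(Q f₀) ⊗ c ⊗ f - 1 ⊗ (ε((Q f₀) ⊗ f) · c) ⊗ 1 + 1 ⊗ c ⊗ ((f₀ - ∂ Q f₀) ⊗ f)`. -/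
def intBase : W Q →ₗ[constants δ] R →ₗ[constants δ] C₁₂ Q →ₗ[constants δ] IDR Q :=
  LinearMap.mk₂ (constants δ)
    (fun f f₀ => tmul' Q f (Q.toLinearMap f₀)
      - tmul' Q 1 1 ∘ₗ LinearMap.mul (constants δ) (C₁₂ Q) (eps₁₂ Q (Q.toRJ f₀) f)
      + tmul' Q (TensorAlgebra.ι _ (Q.toRT f₀) * f) 1)
    (fun f g a => by
      simp only [map_add, mul_add, LinearMap.comp_add, LinearMap.add_apply]; abel)
    (fun r f a => by
      simp only [map_smul, mul_smul_comm, LinearMap.comp_smul, LinearMap.smul_apply, smul_add,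
        smul_sub])
    (fun f a b => by
      simp only [map_add, add_mul, LinearMap.comp_add, LinearMap.add_apply]; abel)
    (fun r f a => by
      simp only [map_smul, smul_mul_assoc, LinearMap.comp_smul, LinearMap.smul_apply, smul_add,
        smul_sub])

/-- The integration of `IDR(R)`, see `int_tmul_one` and `int_tmul_ι_mul`. -/
def int : IDR Q →ₗ[constants δ] IDR Q :=
  lift (wordRec (intBase Q 1) (cons.compr₂ (intBase Q))
    (LinearMap.mk₂ (constants δ)
      (fun m x => -(x ∘ₗ LinearMap.mulRight (constants δ) (m : R) ∘ₗ Q.toLinearMap))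
      (fun a b x => by ext; simp [mul_add]; abel) (fun r a x => by ext; simp)
      (fun a x y => by ext; simp; abel) (fun r a x => by ext; simp)))

/-- `∫(f₀ ⊗ c ⊗ 1) = (Q f₀) ⊗ c ⊗ 1 - 1 ⊗ (ε(Q f₀) · c) ⊗ 1 + 1 ⊗ c ⊗ (f₀ - ∂ Q f₀)`. -/
theorem int_tmul_one (f₀ : R) (c : C₁₂ Q) :
    int Q (tmul Q f₀ c 1) = tmul Q (Q.toLinearMap f₀) c 1
      - tmul Q 1 ((eps₁ Q (Q.toRJ f₀) 1 ⊗ₜ 1) * c) 1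
      + tmul Q 1 c (TensorAlgebra.ι _ (Q.toRT f₀)) := by
  simp [int, intBase, eps₁₂]

/-- `∫(f₀ ⊗ c ⊗ f) = (Q f₀) ⊗ c ⊗ f - 1 ⊗ (ε((Q f₀) ⊗ f) · c) ⊗ 1 - ∫(((Q f₀) f₁) ⊗ c ⊗ t)
+ 1 ⊗ c ⊗ ((f₀ - ∂ Q f₀) ⊗ f)` for `f = f₁ ⊗ t`. -/
theorem int_tmul_ι_mul (f₀ : R) (c : C₁₂ Q) (f₁ : RT Q) (t : W Q) :
    int Q (tmul Q f₀ c (TensorAlgebra.ι _ f₁ * t)) =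
      tmul Q (Q.toLinearMap f₀) c (TensorAlgebra.ι _ f₁ * t)
      - tmul Q 1 ((eps₁ Q (Q.toRJ f₀) (TensorAlgebra.ι _ f₁ * t) ⊗ₜ 1) * c) 1
      - int Q (tmul Q (Q.toLinearMap f₀ * f₁) c t)
      + tmul Q 1 c (TensorAlgebra.ι _ (Q.toRT f₀) * (TensorAlgebra.ι _ f₁ * t)) := by
  simp [int, intBase, eps₁₂]
  abel

end IDR
end IDR
end IntegroDiff

end

noncomputable section

namespace IntegroDiff

/-! ### Linear extension from words, and commutativity of the shuffle product. -/

section Words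

variable {C : Type*} [CommRing C] {M : Type*} [AddCommGroup M] [Module C M]

/-! Write `E = id - ∫∂` for the evaluation. In any commutative integro-differential ring `E` takes
constant values, kills integrals and is linear over constants. The identity `x = ∫∂x + E x`, applied
to a product of two integrals, gives `∫F · ∫G = ∫(F ∫G) + ∫(G ∫F) + E(∫F ∫G)`. Nested integrals
therefore multiply by the shuffle product, corrected by constants `E(∫f ∫g)`. The ring `IDR(R)`
adjoins to `R` the nested integrals of elements of `R_T`, together with generic constants `ε(q ⊗ f)`
and `ε(f ⊙ g)` playing the roles of `E(q ∫f)` and `E(∫f ∫g)`.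

Ring structure: the product of `C₂ ⊗ T` satisfies the recursion above, with prefixing a letter in
the role of integration (`twistedShuffle_ι_mul_ι_mul`). It is commutative, so associativity means
`(x y) z = (z y) x`. Expanding a triple product by first letters leaves three terms covered by
induction and one constant `ε((f g) ⊙ h)`. The generators of `J₂` say exactly that this constant
equals `ε(f ⊙ (g h))` (`map_evalRel`, `mul_right_comm_word`).

Differential structure: the Leibniz rule follows from the same recursion, and `∂∫ = id` by induction
on words. Each `x - ∫∂x` lies in `1 ⊗ C₁ ⊗ C₂ ⊗ 1` (`exists_int_deriv`), so these are all the
constants, and `∫` is visibly linear over them. Sending all `ε` and all nonempty words to zero gives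
a retraction of `ι`, hence injectivity.

Universal property: in `S`, send words to nested integrals and the generators `ε` to the
corresponding evaluations. Already before passing to the quotient by `J₂`, nested integrals multiply
by the twisted shuffle (`constNestedInt_twistedShuffle`). Both halves of a relation thus map to
`E(∫f ∫g ∫h)`, and the map descends to `C₂`. Uniqueness holds because words are iterated integrals
and the `ε` are values of `id - ∫∂`, so `R` generates `IDR(R)` (`induction_generated`). -/

theorem span_range_word : Submodule.span C (Set.range (word C (M := M))) = ⊤ := by
  refine eq_top_iff.2 fun t _ => ?_
  induction t using word_induction with
  | one => exact Submodule.subset_span ⟨[], rfl⟩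
  | add s t hs ht => exact add_mem (hs trivial) (ht trivial)
  | smul c t ht => exact Submodule.smul_mem _ c (ht trivial)
  | cons m t ht =>
    have : Submodule.span C (Set.range (word C (M := M))) ≤
        (Submodule.span C (Set.range (word C (M := M)))).comap (cons m) := by
      rw [Submodule.span_le]
      rintro _ ⟨l, rfl⟩
      exact Submodule.subset_span ⟨m :: l, by simp⟩
    exact this (ht trivial)

theorem linearMap_ext_word {X : Type*} [AddCommGroup X] [Module C X] {F G : T C M →ₗ[C] X}
    (h : ∀ l, F (word C l) = G (word C l)) : F = G :=
  LinearMap.ext_on_range span_range_word h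

theorem linearMap_ext_word₂ {X : Type*} [AddCommGroup X] [Module C X]
    {F G : T C M →ₗ[C] T C M →ₗ[C] X}
    (h : ∀ l l', F (word C l) (word C l') = G (word C l) (word C l')) : F = G :=
  linearMap_ext_word fun l => linearMap_ext_word fun l' => h l l'

theorem shuffle_comm (s t : T C M) : shuffle s t = shuffle t s := by
  suffices h : (shuffle : T C M →ₗ[C] T C M →ₗ[C] T C M) = shuffle.flip from
    congrArg (fun F => F s t) h
  refine linearMap_ext_word₂ fun f => ?_
  induction f with
  | nil => simp
  | cons a s hs =>
    intro g
    induction g with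
    | nil => simp
    | cons b t ht =>
      simp only [LinearMap.flip_apply] at hs ht ⊢
      rw [word_cons, word_cons, shuffle_ι_mul_ι_mul, shuffle_ι_mul_ι_mul, ← word_cons, ← word_cons,
        hs, ht, add_comm]

/-! ### The twisted shuffle product -/

section TwistedShuffle

variable {A : Type*} [CommRing A] [Algebra C A] (e : T C M →ₗ[C] T C M →ₗ[C] A)

/-- `(f' ⊗ f'', g' ⊗ g'') ↦ e(f'', g'') ⊗ (f' ⧢ g')`. -/
def twist : (T C M ⊗[C] T C M) →ₗ[C] (T C M ⊗[C] T C M) →ₗ[C] A ⊗[C] T C M :=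
  (TensorProduct.map₂ shuffle e).compr₂ (TensorProduct.comm C (T C M) A).toLinearMap

theorem twist_tmul_tmul (p q r s : T C M) :
    twist e (p ⊗ₜ q) (r ⊗ₜ s) = e q s ⊗ₜ shuffle p r := rfl

/-- The product `(f, g) ↦ 1 ⊗ (f ⧢ g) + ∑ e(f'', g'') ⊗ (f' ⧢ g')` with values in `A ⊗ T(M)`,
the sum running over the deconcatenations of `f` and `g`. -/
def twistedShuffle : T C M →ₗ[C] T C M →ₗ[C] A ⊗[C] T C M :=
  shuffle.compr₂ (TensorProduct.mk C A (T C M) 1) + (twist e).compl₁₂ decon decon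

theorem twistedShuffle_apply (f g : T C M) :
    twistedShuffle e f g = 1 ⊗ₜ shuffle f g + twist e (decon f) (decon g) := rfl

theorem twistedShuffle_eps₂ : twistedShuffle (eps₂ : T C M →ₗ[C] _) = C₂T.mulT C M := rfl

variable {e}

theorem tensor_ext₂ {X : Type*} [AddCommGroup X] [Module C X]
    {F G : (T C M ⊗[C] T C M) →ₗ[C] (T C M ⊗[C] T C M) →ₗ[C] X}
    (h : ∀ p q r s, F (p ⊗ₜ q) (r ⊗ₜ s) = G (p ⊗ₜ q) (r ⊗ₜ s)) : F = G :=
  TensorProduct.ext' fun p q => TensorProduct.ext' fun r s => h p q r s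

theorem twist_comm (h : ∀ f g, e f g = e g f) (x y : T C M ⊗[C] T C M) :
    twist e x y = twist e y x := by
  suffices h : twist e = (twist e).flip from congrArg (fun F => F x y) h
  refine tensor_ext₂ fun p q r s => ?_
  rw [LinearMap.flip_apply, twist_tmul_tmul, twist_tmul_tmul, h, shuffle_comm]

theorem twistedShuffle_comm (h : ∀ f g, e f g = e g f) (f g : T C M) :
    twistedShuffle e f g = twistedShuffle e g f := by
  rw [twistedShuffle_apply, twistedShuffle_apply, twist_comm h, shuffle_comm]

theorem twistedShuffle_one_right (h : ∀ g, e g 1 = 0) (g : T C M) :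
    twistedShuffle e g 1 = 1 ⊗ₜ g := by
  have h : (twist e).flip ((1 : T C M) ⊗ₜ[C] (1 : T C M)) = 0 :=
    TensorProduct.ext' fun p q => by
      rw [LinearMap.flip_apply, twist_tmul_tmul, h, TensorProduct.zero_tmul]; rfl
  have h' := LinearMap.congr_fun h (decon g)
  rw [LinearMap.flip_apply] at h'
  rw [twistedShuffle_apply, decon_one, h', shuffle_one_right]
  exact add_zero _

/-- When one prefix is empty, the shuffle of prefixes is the other prefix, so its first letter can
be pulled out. -/
theorem twist_one_tmul_left (b : M) (f : T C M) (x : T C M ⊗[C] T C M) :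
    twist e (1 ⊗ₜ f) ((cons b).rTensor _ x) = (cons b).lTensor A (twist e (1 ⊗ₜ f) x) := by
  suffices h : twist e (1 ⊗ₜ f) ∘ₗ (cons b).rTensor _ = (cons b).lTensor A ∘ₗ twist e (1 ⊗ₜ f) from
    LinearMap.congr_fun h x
  refine TensorProduct.ext' fun p q => ?_
  simp only [LinearMap.comp_apply, LinearMap.rTensor_tmul, LinearMap.lTensor_tmul, twist_tmul_tmul,
    shuffle_one_left]

theorem twist_one_tmul_right (a : M) (g : T C M) (x : T C M ⊗[C] T C M) :
    twist e ((cons a).rTensor _ x) (1 ⊗ₜ g) = (cons a).lTensor A (twist e x (1 ⊗ₜ g)) := by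
  suffices h : (twist e).flip (1 ⊗ₜ g) ∘ₗ (cons a).rTensor _ =
      (cons a).lTensor A ∘ₗ (twist e).flip (1 ⊗ₜ g) from LinearMap.congr_fun h x
  refine TensorProduct.ext' fun p q => ?_
  simp only [LinearMap.comp_apply, LinearMap.rTensor_tmul, LinearMap.lTensor_tmul, twist_tmul_tmul,
    shuffle_one_right, LinearMap.flip_apply]

theorem twist_rTensor_rTensor (a b : M) (x y : T C M ⊗[C] T C M) :
    twist e ((cons a).rTensor _ x) ((cons b).rTensor _ y) =
      (cons a).lTensor A (twist e x ((cons b).rTensor _ y)) +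
      (cons b).lTensor A (twist e ((cons a).rTensor _ x) y) := by
  suffices h : (twist e).compl₁₂ ((cons a).rTensor _) ((cons b).rTensor _) =
      ((twist e).compl₂ ((cons b).rTensor _)).compr₂ ((cons a).lTensor A) +
      ((twist e) ∘ₗ ((cons a).rTensor _)).compr₂ ((cons b).lTensor A) from
    congrArg (fun F => F x y) h
  refine tensor_ext₂ fun p q r s => ?_
  simp only [LinearMap.compl₁₂_apply, LinearMap.add_apply, LinearMap.compr₂_apply,
    LinearMap.compl₂_apply, LinearMap.comp_apply, LinearMap.rTensor_tmul, LinearMap.lTensor_tmul,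
    twist_tmul_tmul, cons_apply, shuffle_ι_mul_ι_mul, TensorProduct.tmul_add]

/-- The algebraic form of `∫F · ∫G = ∫(F ∫G) + ∫(G ∫F) + E(∫F ∫G)`. Each deconcatenation splits into
the cut with empty prefix and the cuts whose prefix contains the first letter. The pair of empty
prefixes gives the term in `e`; in every other pair the shuffle of prefixes starts with `a` or `b`.
-/
theorem twistedShuffle_ι_mul_ι_mul (a b : M) (s t : T C M) :
    twistedShuffle e (TensorAlgebra.ι C a * s) (TensorAlgebra.ι C b * t) =
      (cons a).lTensor A (twistedShuffle e s (TensorAlgebra.ι C b * t)) +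
      (cons b).lTensor A (twistedShuffle e (TensorAlgebra.ι C a * s) t) +
      e (TensorAlgebra.ι C a * s) (TensorAlgebra.ι C b * t) ⊗ₜ 1 := by
  have h : ∀ x y : T C M, twist e (1 ⊗ₜ x + (cons a).rTensor _ (decon s))
      (1 ⊗ₜ y + (cons b).rTensor _ (decon t)) = e x y ⊗ₜ 1 +
      (cons b).lTensor A (twist e (1 ⊗ₜ x) (decon t)) +
      (cons a).lTensor A (twist e (decon s) (1 ⊗ₜ y)) +
      ((cons a).lTensor A (twist e (decon s) ((cons b).rTensor _ (decon t))) +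
      (cons b).lTensor A (twist e ((cons a).rTensor _ (decon s)) (decon t))) := fun x y => by
    rw [LinearMap.map_add₂, (twist e (1 ⊗ₜ x)).map_add,
      (twist e ((cons a).rTensor _ (decon s))).map_add, twist_rTensor_rTensor,
      twist_one_tmul_left, twist_one_tmul_right, twist_tmul_tmul, shuffle_one_left]
    abel
  rw [twistedShuffle_apply, decon_ι_mul, decon_ι_mul, h, twistedShuffle_apply,
    twistedShuffle_apply, decon_ι_mul, decon_ι_mul, (twist e (decon s)).map_add,
    LinearMap.map_add₂ (twist e), shuffle_ι_mul_ι_mul, TensorProduct.tmul_add, LinearMap.map_add,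
    LinearMap.map_add, LinearMap.map_add, LinearMap.map_add, LinearMap.lTensor_tmul,
    LinearMap.lTensor_tmul, cons_apply, cons_apply]
  abel

/-- Cuts with an empty suffix drop out because `e` vanishes on `1`; this shortens both ranges by
one. -/
theorem twistedShuffle_word (h₁ : ∀ g, e 1 g = 0) (h₂ : ∀ g, e g 1 = 0) (f g : List M) :
    twistedShuffle e (word C f) (word C g) = 1 ⊗ₜ shuffle (word C f) (word C g) +
      ∑ i ∈ Finset.range f.length, ∑ j ∈ Finset.range g.length,
        e (word C (f.drop i)) (word C (g.drop j)) ⊗ₜ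
          shuffle (word C (f.take i)) (word C (g.take j)) := by
  rw [twistedShuffle_apply, decon_word, decon_word, LinearMap.map_sum₂]
  simp only [map_sum, twist_tmul_tmul]
  simp only [Finset.sum_range_succ, List.drop_length,
    word_nil, h₁, h₂, TensorProduct.zero_tmul, add_zero, Finset.sum_const_zero]

variable (e) in
/-- `a ⊗ t ↦ a * e t h`. -/
def evalRight (h : T C M) : A ⊗[C] T C M →ₗ[C] A :=
  LinearMap.mul' C A ∘ₗ (e.flip h).lTensor A

@[simp] theorem evalRight_tmul (h : T C M) (a : A) (t : T C M) :
    evalRight e h (a ⊗ₜ t) = a * e t h := by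
  simp [evalRight]

theorem evalRight_twistedShuffle_word (h₁ : ∀ g, e 1 g = 0) (h₂ : ∀ g, e g 1 = 0)
    (f g : List M) (h : T C M) :
    evalRight e h (twistedShuffle e (word C f) (word C g)) = e (shuffle (word C f) (word C g)) h +
      ∑ j ∈ Finset.range g.length, ∑ i ∈ Finset.range f.length,
        e (word C (f.drop i)) (word C (g.drop j)) *
          e (shuffle (word C (f.take i)) (word C (g.take j))) h := by
  rw [twistedShuffle_word h₁ h₂, LinearMap.map_add, evalRight_tmul, one_mul, Finset.sum_comm]
  simp only [_root_.map_sum (evalRight e h), evalRight_tmul]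

end TwistedShuffle

/-! ### The relations among evaluations, rewritten with the twisted shuffle. -/

section Evaluations

theorem preEps₂_one_left (g : T C M) : preEps₂ 1 g = 0 := by
  simp [preEps₂, tildeProj_one]

theorem preEps₂_one_right (g : T C M) : preEps₂ g 1 = 0 := by
  simp [preEps₂, tildeProj_one]

theorem preEps₂_comm (f g : T C M) : preEps₂ f g = preEps₂ g f := by
  have h : M₂.mk C M (tildeProj f ⊗ₜ tildeProj g) = M₂.mk C M (tildeProj g ⊗ₜ tildeProj f) :=
    (Submodule.Quotient.eq _).2 (Submodule.subset_span ⟨_, _, rfl⟩)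
  simp [preEps₂, h]

theorem eps₂_comm (f g : T C M) : eps₂ f g = eps₂ g f := by
  simp only [eps₂, LinearMap.compr₂_apply, preEps₂_comm f g]

/-- The lower bound `1 - j` omits only the term with both indices zero. In the relations that term
has an evaluation with an empty argument, which is zero by convention. -/
theorem sum_Ico_one_sub_eq_sum_range {X : Type*} [AddCommMonoid X] (F : ℕ → X) (j n : ℕ)
    (h : j = 0 → F 0 = 0) : ∑ i ∈ Finset.Ico (1 - j) n, F i = ∑ i ∈ Finset.range n, F i := by
  refine Finset.sum_subset (fun i hi => by simp at hi ⊢; omega) fun i hi hi' => ?_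
  simp only [Finset.mem_Ico, Finset.mem_range, not_and, not_lt] at hi hi'
  obtain ⟨rfl, rfl⟩ : i = 0 ∧ j = 0 := by omega
  exact h rfl

/-- The relation among evaluations is the difference of `ε((f g) ⊙ h)` and `ε(f ⊙ (g h))`, where
`f g` and `g h` are twisted shuffle products. -/
theorem map_evalRel {A : Type*} [CommRing A] [Algebra C A]
    (ψ : SymmetricAlgebra C (M₂ C M) →ₐ[C] A) (f g h : List M) :
    ψ (evalRel f g h) =
      evalRight (preEps₂.compr₂ ψ.toLinearMap) (word C h)
        (twistedShuffle (preEps₂.compr₂ ψ.toLinearMap) (word C f) (word C g)) -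
      evalRight (preEps₂.compr₂ ψ.toLinearMap) (word C f)
        (twistedShuffle (preEps₂.compr₂ ψ.toLinearMap) (word C h) (word C g)) := by
  have hs : evalRel f g h = preEps₂ (shuffle (word C f) (word C g)) (word C h)
      - preEps₂ (word C f) (shuffle (word C g) (word C h))
      + ∑ j ∈ Finset.range g.length,
        (∑ i ∈ Finset.range f.length, preEps₂ (word C (f.drop i)) (word C (g.drop j)) *
            preEps₂ (shuffle (word C (f.take i)) (word C (g.take j))) (word C h)
        - ∑ k ∈ Finset.range h.length,
          preEps₂ (word C f) (shuffle (word C (g.take j)) (word C (h.take k))) *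
            preEps₂ (word C (g.drop j)) (word C (h.drop k))) := by
    rw [evalRel]
    congr 1
    refine Finset.sum_congr rfl fun j _ => ?_
    rw [sum_Ico_one_sub_eq_sum_range, sum_Ico_one_sub_eq_sum_range]
    · rintro rfl
      rw [List.take_zero, List.take_zero, word_nil, shuffle_one_left, preEps₂_one_right, zero_mul]
    · rintro rfl
      rw [List.take_zero, List.take_zero, word_nil, shuffle_one_left, preEps₂_one_left, mul_zero]
  have h₁ : ∀ g : T C M, preEps₂.compr₂ ψ.toLinearMap 1 g = 0 := by simp [preEps₂_one_left]
  have h₂ : ∀ g : T C M, preEps₂.compr₂ ψ.toLinearMap g 1 = 0 := by simp [preEps₂_one_right]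
  have h₃ : ∀ f g : T C M, preEps₂.compr₂ ψ.toLinearMap f g =
      preEps₂.compr₂ ψ.toLinearMap g f := fun f g => by
    simp only [LinearMap.compr₂_apply, preEps₂_comm f g]
  have h₄ : ∀ f g : T C M, ψ (preEps₂ f g) = preEps₂.compr₂ ψ.toLinearMap f g := fun _ _ => rfl
  rw [hs, evalRight_twistedShuffle_word h₁ h₂, evalRight_twistedShuffle_word h₁ h₂]
  simp only [map_add ψ, map_sub ψ, map_sum ψ, map_mul ψ, h₄]
  generalize preEps₂.compr₂ ψ.toLinearMap = e at *
  -- By symmetry of `e` and of the shuffle, the subtracted sum is the correction term of the product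
  -- of `h` and `g`, paired with `f`.
  have h₅ : ∀ j k, e (word C f) (shuffle (word C (g.take j)) (word C (h.take k))) *
      e (word C (g.drop j)) (word C (h.drop k)) =
      e (word C (h.drop k)) (word C (g.drop j)) *
      e (shuffle (word C (h.take k)) (word C (g.take j))) (word C f) := fun j k => by
    rw [mul_comm, h₃ (word C f), shuffle_comm, h₃ (word C (g.drop j))]
  rw [Finset.sum_sub_distrib]
  simp only [h₅]
  rw [h₃ (word C f), shuffle_comm (word C g)]
  abel

end Evaluations

end Words

section Words
variable {C : Type*} [CommRing C] {M : Type*} [AddCommGroup M] [Module C M]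

/-! ### The commutative ring `C₂ ⊗ T(M)` -/

namespace C₂T

instance : Module (C₂ C M) (C₂T C M) := inferInstanceAs (Module (C₂ C M) (C₂ C M ⊗[C] T C M))

theorem smul_mk (c d : C₂ C M) (f : T C M) : c • (mk d f : C₂T C M) = mk (c * d) f := rfl

/-- Left multiplication by a letter on `C₂ ⊗ T(M)`. -/
def consMap (a : M) : C₂T C M →ₗ[C₂ C M] C₂T C M := (cons a).baseChange (C₂ C M)

theorem consMap_mk (a : M) (c : C₂ C M) (f : T C M) :
    consMap a (mk c f) = mk c (TensorAlgebra.ι C a * f) := rfl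

/-- `c ⊗ f ↦ c ε(f ⊙ h)`. -/
def eval (h : T C M) : C₂T C M →ₗ[C₂ C M] C₂ C M where
  toFun := evalRight eps₂ h
  map_add' := map_add (evalRight eps₂ h)
  map_smul' c x := by
    refine TensorProduct.induction_on (motive := fun x : C₂ C M ⊗[C] T C M =>
      evalRight eps₂ h (c • x) = c * evalRight eps₂ h x) x ?_ (fun d f => ?_) fun x y hx hy => ?_
    · rw [smul_zero, map_zero, mul_zero]
    · rw [TensorProduct.smul_tmul', evalRight_tmul, evalRight_tmul, smul_eq_mul, mul_assoc]
    · rw [smul_add, map_add, hx, hy, map_add, mul_add]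

theorem eval_mk (h : T C M) (c : C₂ C M) (f : T C M) : eval h (mk c f) = c * eps₂ f h :=
  evalRight_tmul h c f

/-- Reduces `C₂`-linear identities, such as associativity, to words with coefficient `1`. -/
theorem induction_smul_word {p : C₂T C M → Prop} (x : C₂T C M)
    (add : ∀ x y, p x → p y → p (x + y)) (smul : ∀ (c : C₂ C M) x, p x → p (c • x))
    (word : ∀ f, p (mk 1 (word C f))) : p x := by
  have h : ∀ t, p (mk 1 t) := fun t => by
    have ht : t ∈ Submodule.span C (Set.range (IntegroDiff.word C (M := M))) := by
      rw [span_range_word]; trivial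
    induction ht using Submodule.span_induction with
    | mem t h => obtain ⟨l, rfl⟩ := h; exact word l
    | zero => simpa using smul 0 _ (word [])
    | add s t _ _ hs ht => rw [map_add]; exact add _ _ hs ht
    | smul c t _ ht =>
      have h := smul (algebraMap C (C₂ C M) c) _ ht
      rw [smul_mk, mul_one, Algebra.algebraMap_eq_smul_one, map_smul] at h
      rwa [map_smul]
  induction x using induction_on with
  | zero => simpa using smul 0 _ (word [])
  | mk c f => rw [← mul_one c, ← smul_mk]; exact smul _ _ (h f)
  | add x y hx hy => exact add _ _ hx hy

theorem mk_mul_mk (c d : C₂ C M) (f g : T C M) :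
    mk c f * mk d g = (c * d) • (mk 1 f * mk 1 g) := by
  have h : ∀ (c : C₂ C M) (x : C₂ C M ⊗[C] T C M),
      ((LinearMap.mulLeft C c).rTensor (T C M) x : C₂T C M) = c • (x : C₂T C M) := fun c x => by
    induction x using TensorProduct.induction_on with
    | zero => exact (map_zero _).trans (smul_zero c).symm
    | tmul a b => rfl
    | add x y hx hy => exact (map_add _ _ _).trans ((congrArg₂ _ hx hy).trans (smul_add c _ _).symm)
  rw [mul_def, mulMap_mk_mk, mul_def, mulMap_mk_mk, mul_one]
  exact (h _ _).trans (congrArg _ ((h 1 _).trans (one_smul _ _)).symm)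

theorem mk_one_mul_mk_one (f g : T C M) : mk 1 f * mk 1 g = twistedShuffle eps₂ f g := by
  rw [mul_def, mulMap_mk_mk, twistedShuffle_eps₂, mul_one]
  have h : LinearMap.mulLeft C (1 : C₂ C M) = LinearMap.id := LinearMap.ext one_mul
  rw [h]
  exact LinearMap.congr_fun (LinearMap.rTensor_id _ _) _

theorem smul_mul_mk (c d : C₂ C M) (f : T C M) (x : C₂T C M) :
    (c • mk d f) * x = c • (mk d f * x) := by
  induction x using induction_on with
  | zero => rw [mul_zero, mul_zero, smul_zero]
  | mk e g => rw [smul_mk, mk_mul_mk, mk_mul_mk d, smul_smul, mul_assoc]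
  | add x y hx hy => rw [mul_add, hx, hy, mul_add, smul_add]

instance : IsScalarTower (C₂ C M) (C₂T C M) (C₂T C M) where
  smul_assoc c x y := by
    rw [smul_eq_mul, smul_eq_mul]
    induction x using induction_on with
    | zero => rw [smul_zero, zero_mul, smul_zero]
    | mk d f => exact smul_mul_mk c d f y
    | add x x' hx hy => rw [smul_add, add_mul, hx, hy, add_mul, smul_add]

protected theorem mul_comm (x y : C₂T C M) : x * y = y * x := by
  induction x using induction_on with
  | zero => rw [mul_zero, zero_mul]
  | mk c f =>
    induction y using induction_on with
    | zero => rw [mul_zero, zero_mul]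
    | mk d g =>
      rw [mk_mul_mk, mk_mul_mk d, mk_one_mul_mk_one, mk_one_mul_mk_one,
        twistedShuffle_comm eps₂_comm, mul_comm]
    | add x y hx hy => rw [mul_add, add_mul, hx, hy]
  | add x y hx hy => rw [mul_add, add_mul, hx, hy]

instance : SMulCommClass (C₂ C M) (C₂T C M) (C₂T C M) where
  smul_comm c x y := by
    rw [smul_eq_mul, smul_eq_mul, C₂T.mul_comm x, C₂T.mul_comm x, smul_mul_assoc]

theorem eval_one (h : T C M) : eval h 1 = 0 := by
  rw [one_def, eval_mk, eps₂_one_left, mul_zero]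

/-- The product recursion with an arbitrary left factor `x`: in a triple product, what follows the
first letter is itself a product and no longer a pure tensor. -/
theorem consMap_mul_mk_cons (a b : M) (x : C₂T C M) (t : T C M) :
    consMap a x * mk 1 (TensorAlgebra.ι C b * t) =
      consMap a (x * mk 1 (TensorAlgebra.ι C b * t)) + consMap b (consMap a x * mk 1 t) +
      eval (TensorAlgebra.ι C b * t) (consMap a x) • (1 : C₂T C M) := by
  induction x using induction_on with
  | zero => simp only [map_zero, zero_mul, zero_smul, add_zero]
  | mk c f =>
    have h : ∀ g : T C M, mk c g = c • mk 1 g := fun g => by rw [smul_mk, mul_one]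
    rw [h, map_smul]
    simp only [smul_mul_assoc, map_smul, smul_eq_mul, mul_smul, ← smul_add]
    congr 1
    rw [consMap_mk, mk_one_mul_mk_one, mk_one_mul_mk_one, mk_one_mul_mk_one, eval_mk, one_mul]
    refine (twistedShuffle_ι_mul_ι_mul a b f t).trans (congrArg _ ?_)
    rw [one_def, smul_mk, mul_one]
    rfl
  | add x y hx hy =>
    rw [map_add, add_mul, hx, hy]
    simp only [add_mul, map_add, add_smul]
    abel

theorem mk_cons_mul_mk_cons (a b : M) (f g : T C M) :
    (mk 1 (TensorAlgebra.ι C a * f) * mk 1 (TensorAlgebra.ι C b * g) : C₂T C M) =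
      consMap a (mk 1 f * mk 1 (TensorAlgebra.ι C b * g)) +
      consMap b (mk 1 (TensorAlgebra.ι C a * f) * mk 1 g) +
      eps₂ (TensorAlgebra.ι C a * f) (TensorAlgebra.ι C b * g) • (1 : C₂T C M) := by
  have h := consMap_mul_mk_cons a b (mk 1 f) g
  rwa [consMap_mk, eval_mk, one_mul] at h

/-- This is the defining relation of `C₂`, read as the symmetry in `f` and `h` of the constant term
of a triple product. -/
theorem eval_mul (f g h : List M) (hf : f ≠ []) (hg : g ≠ []) (hh : h ≠ []) :
    eval (word C h) (mk 1 (word C f) * mk 1 (word C g)) =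
      eval (word C f) (mk 1 (word C h) * mk 1 (word C g)) := by
  have h₀ : C₂.proj C M (evalRel f g h) = 0 :=
    Ideal.Quotient.eq_zero_iff_mem.2 (Ideal.subset_span ⟨f, g, h, hf, hg, hh, rfl⟩)
  rw [map_evalRel] at h₀
  rw [mk_one_mul_mk_one, mk_one_mul_mk_one]
  exact sub_eq_zero.1 h₀

/-- The counterpart of integrating the Leibniz rule for three integrals. Everything but the last
term visibly becomes the expansion of `(h g) f` once associativity is known for shorter words. -/
theorem mul_mul_expand (a b c : M) (f g h : T C M) :
    (mk 1 (TensorAlgebra.ι C a * f) * mk 1 (TensorAlgebra.ι C b * g) : C₂T C M) *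
        mk 1 (TensorAlgebra.ι C c * h) =
      consMap a (mk 1 f * mk 1 (TensorAlgebra.ι C b * g) * mk 1 (TensorAlgebra.ι C c * h)) +
      consMap b (mk 1 (TensorAlgebra.ι C a * f) * mk 1 g * mk 1 (TensorAlgebra.ι C c * h)) +
      consMap c (mk 1 (TensorAlgebra.ι C a * f) * mk 1 (TensorAlgebra.ι C b * g) * mk 1 h) +
      eval (TensorAlgebra.ι C c * h)
        (mk 1 (TensorAlgebra.ι C a * f) * mk 1 (TensorAlgebra.ι C b * g)) • (1 : C₂T C M) := by
  conv_lhs => rw [mk_cons_mul_mk_cons, add_mul, add_mul, consMap_mul_mk_cons, consMap_mul_mk_cons,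
    smul_mul_assoc, one_mul]
  conv_rhs => rw [mk_cons_mul_mk_cons a b f g]
  simp only [add_mul, map_add, add_smul, smul_mul_assoc, one_mul, map_smul, eval_one, smul_zero,
    add_zero, consMap_mk]
  abel

theorem mul_right_comm_word (f g h : List M) :
    (mk 1 (word C f) * mk 1 (word C g) * mk 1 (word C h) : C₂T C M) =
      mk 1 (word C h) * mk 1 (word C g) * mk 1 (word C f) := by
  induction f generalizing g h with
  | nil => rw [word_nil, ← one_def, one_mul, mul_one, C₂T.mul_comm]
  | cons a f hf =>
    induction g generalizing h with
    | nil => rw [word_nil, ← one_def, mul_one, mul_one, C₂T.mul_comm]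
    | cons b g hg =>
      induction h with
      | nil => rw [word_nil, ← one_def, mul_one, one_mul, C₂T.mul_comm]
      | cons c h hh =>
        have h₁ := hf (b :: g) (c :: h)
        have h₂ := hg (c :: h)
        have h₃ := eval_mul (C := C) (a :: f) (b :: g) (c :: h) (by simp) (by simp) (by simp)
        simp only [word_cons] at h₁ h₂ h₃ hh ⊢
        -- `h₁`, `h₂`, `hh` treat the terms in which the first, second or third word is shortened,
        -- and `h₃` matches the constants.
        rw [mul_mul_expand, mul_mul_expand c b a, h₁, h₂, h₃, hh]
        abel

protected theorem mul_assoc (x y z : C₂T C M) : x * y * z = x * (y * z) := by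
  -- Given commutativity, reversing the factors is equivalent to associativity and has the symmetry
  -- of the relations.
  suffices h : x * y * z = z * y * x by rw [h, C₂T.mul_comm x, C₂T.mul_comm z]
  induction x using induction_smul_word with
  | add x x' hx hx' => simp only [add_mul, mul_add, hx, hx']
  | smul c x hx => simp only [smul_mul_assoc, mul_smul_comm, hx]
  | word f =>
    induction y using induction_smul_word with
    | add x x' hx hx' => simp only [add_mul, mul_add, hx, hx']
    | smul c x hx => simp only [smul_mul_assoc, mul_smul_comm, hx]
    | word g =>
      induction z using induction_smul_word with
      | add x x' hx hx' => simp only [add_mul, mul_add, hx, hx']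
      | smul c x hx => simp only [smul_mul_assoc, mul_smul_comm, hx]
      | word h => exact mul_right_comm_word f g h

end C₂T
end Words

/-! ### First-letter decomposition of `C₂ ⊗ T(M)` and augmentations. -/

section Words
variable {C : Type*} [CommRing C] {M : Type*} [AddCommGroup M] [Module C M]
namespace C₂T

/-- The derivation of `IDR(R)` strips a first letter, so its natural cases are multiples of `1` and
elements with a letter in front. -/
theorem induction_cons {p : C₂T C M → Prop} (x : C₂T C M)
    (const : ∀ c : C₂ C M, p (c • 1)) (cons : ∀ a x, p (consMap a x))
    (add : ∀ x y, p x → p y → p (x + y)) : p x := by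
  have h : ∀ f c, p (mk c f) := fun f => by
    induction f using word_induction with
    | one => intro c; simpa only [one_def, smul_mk, mul_one] using const c
    | add s t hs ht => intro c; rw [map_add]; exact add _ _ (hs c) (ht c)
    | smul r t ht => intro c; rw [map_smul, ← LinearMap.map_smul₂]; exact ht _
    | cons a t => intro c; rw [← consMap_mk]; exact cons _ _
  induction x using induction_on with
  | zero => simpa using const 0
  | mk c f => exact h f c
  | add x y hx hy => exact add x y hx hy

/-- For the Leibniz rule the value of `e` is irrelevant: only its being a constant matters. -/
theorem exists_consMap_mul_consMap (a b : M) (x y : C₂T C M) :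
    ∃ e : C₂ C M, consMap a x * consMap b y =
      consMap a (x * consMap b y) + consMap b (consMap a x * y) + e • (1 : C₂T C M) := by
  induction y using induction_on with
  | zero => exact ⟨0, by simp only [map_zero, mul_zero, zero_smul, add_zero]⟩
  | mk d g =>
    refine ⟨d * eval (TensorAlgebra.ι C b * g) (consMap a x), ?_⟩
    have h : ∀ g : T C M, mk d g = d • mk 1 g := fun g => by rw [smul_mk, mul_one]
    rw [h, map_smul]
    simp only [mul_smul_comm, map_smul, mul_smul, ← smul_add]
    rw [consMap_mk, consMap_mul_mk_cons]
  | add y z hy hz =>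
    obtain ⟨e, he⟩ := hy
    obtain ⟨e', he'⟩ := hz
    refine ⟨e + e', ?_⟩
    rw [map_add, mul_add, he, he']
    simp only [mul_add, map_add, add_smul]
    abel

end C₂T

/-- The augmentation of `C₂`, with `ε(f ⊙ g) ↦ 0`. -/
def C₂.aug : C₂ C M →ₐ[C] C :=
  Ideal.Quotient.liftₐ (J₂ C M) SymmetricAlgebra.algebraMapInv fun x hx => by
    suffices h : J₂ C M ≤ RingHom.ker (SymmetricAlgebra.algebraMapInv (R := C) (M := M₂ C M)) from
      h hx
    refine Ideal.span_le.2 ?_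
    rintro _ ⟨f, g, h, -, -, -, rfl⟩
    -- The augmentation turns the pairing into `0`, and both halves of a relation are built from
    -- pairings.
    have he : (preEps₂ : T C M →ₗ[C] T C M →ₗ[C] _).compr₂
        (SymmetricAlgebra.algebraMapInv (R := C) (M := M₂ C M)).toLinearMap = 0 :=
      LinearMap.ext₂ fun f g => SymmetricAlgebra.algebraMapInv_ι _
    have h₀ : ∀ h x, evalRight (0 : T C M →ₗ[C] T C M →ₗ[C] C) h x = 0 := fun h x => by
      induction x using TensorProduct.induction_on with
      | zero => exact map_zero _
      | tmul a t => exact (evalRight_tmul _ _ _).trans (mul_zero _)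
      | add x y hx hy => rw [map_add, hx, hy, add_zero]
    refine RingHom.mem_ker.2 ?_
    rw [map_evalRel, he, h₀, h₀, sub_zero]

/-- The augmentation of `C₂ ⊗ T(M)`. -/
def C₂T.aug : C₂T C M →ₗ[C] C :=
  LinearMap.mul' C C ∘ₗ TensorProduct.map C₂.aug.toLinearMap
    (TensorAlgebra.algebraMapInv (R := C) (M := M)).toLinearMap

theorem C₂T.aug_one : C₂T.aug (1 : C₂T C M) = 1 := by
  change LinearMap.mul' C C (TensorProduct.map _ _ ((1 : C₂ C M) ⊗ₜ[C] (1 : T C M))) = 1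
  simp

end Words

/-! ### Ring axioms, derivation and integration of `IDR(R)`; injectivity of `ι`. -/

section IDR

variable {R : Type*} [CommRing R] {δ : Derivation ℤ R R} (Q : QuasiIntegration δ)

/-- The component of `f` in the constants with respect to `R = ker δ ⊕ R_J`. -/
def QuasiIntegration.toConst (f : R) : constants δ :=
  ⟨f - Q.toLinearMap (δ f), by
    change δ _ = 0
    rw [map_sub, Q.deriv_comp_deriv, sub_self]⟩

theorem QuasiIntegration.toRJ_deriv (f : RJ Q) : Q.toRJ (δ f) = f := by
  obtain ⟨_, g, rfl⟩ := f
  exact Subtype.ext (Q.comp_deriv_comp g)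

theorem QuasiIntegration.toRT_deriv (f : R) : Q.toRT (δ f) = 0 :=
  Subtype.ext (by simp [toRT, Q.deriv_comp_deriv])

theorem QuasiIntegration.toRT_coe (f : RT Q) : Q.toRT f = f := by
  have h : Q.toLinearMap f = 0 := f.2
  exact Subtype.ext (by simp [toRT, h])

theorem QuasiIntegration.toRJ_coe (f : RT Q) : Q.toRJ f = 0 :=
  Subtype.ext f.2

namespace IDR

/-- The pure tensor `r ⊗ c ⊗ x` with `x ∈ C₂ ⊗ T(R_T)`. -/
def pure (r : R) (c : C₁ Q) (x : C₂T (constants δ) (RT Q)) : IDR Q :=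
  r ⊗ₜ[constants δ] (c ⊗ₜ[constants δ] x)

theorem tmul_eq_pure (r : R) (c : C₁ Q) (d : C₂ (constants δ) (RT Q)) (f : W Q) :
    tmul Q r (c ⊗ₜ d) f = pure Q r c (C₂T.mk d f) := rfl

theorem pure_mul_pure (r s : R) (c d : C₁ Q) (x y : C₂T (constants δ) (RT Q)) :
    pure Q r c x * pure Q s d y = pure Q (r * s) (c * d) (x * y) :=
  (Algebra.TensorProduct.tmul_mul_tmul (R := constants δ) r s
    (c ⊗ₜ[constants δ] x) (d ⊗ₜ[constants δ] y)).trans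
      (congrArg _ (Algebra.TensorProduct.tmul_mul_tmul _ _ _ _))

theorem pure_add (r : R) (c : C₁ Q) (x y : C₂T (constants δ) (RT Q)) :
    pure Q r c (x + y) = pure Q r c x + pure Q r c y :=
  (congrArg (r ⊗ₜ[constants δ] ·) (TensorProduct.tmul_add c x y)).trans
    (TensorProduct.tmul_add r _ _)

theorem add_pure (r s : R) (c : C₁ Q) (x : C₂T (constants δ) (RT Q)) :
    pure Q (r + s) c x = pure Q r c x + pure Q s c x :=
  TensorProduct.add_tmul r s _

theorem pure_zero (r : R) (c : C₁ Q) : pure Q r c 0 = 0 :=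
  (congrArg (r ⊗ₜ[constants δ] ·) (TensorProduct.tmul_zero _ c)).trans (TensorProduct.tmul_zero _ r)

variable {Q} in
theorem induction_pure {p : IDR Q → Prop} (x : IDR Q) (zero : p 0)
    (pure : ∀ r c x, p (pure Q r c x)) (add : ∀ x y, p x → p y → p (x + y)) : p x := by
  refine TensorProduct.induction_on (motive := p) x zero (fun r y => ?_) add
  refine TensorProduct.induction_on (motive := fun y => p (r ⊗ₜ[constants δ] y)) y ?_
    (fun c x => pure r c x) fun x y hx hy => ?_
  · rw [TensorProduct.tmul_zero]; exact zero
  · rw [TensorProduct.tmul_add]; exact add _ _ hx hy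

variable {Q} in
theorem induction_tmul {p : IDR Q → Prop} (x : IDR Q) (zero : p 0)
    (tmul : ∀ r c f, p (tmul Q r c f)) (add : ∀ x y, p x → p y → p (x + y)) : p x := by
  induction x using induction_pure with
  | zero => exact zero
  | pure r c x =>
    induction x using C₂T.induction_on with
    | zero => rw [pure_zero]; exact zero
    | mk d f => exact tmul r (c ⊗ₜ d) f
    | add x y hx hy => rw [pure_add]; exact add _ _ hx hy
  | add x y hx hy => exact add _ _ hx hy

theorem smul_pure (k : constants δ) (r : R) (c : C₁ Q) (x : C₂T (constants δ) (RT Q)) :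
    k • pure Q r c x = pure Q (k • r) c x := rfl

instance : SMulCommClass (constants δ) (IDR Q) (IDR Q) where
  smul_comm k x y := by
    rw [smul_eq_mul, smul_eq_mul]
    induction x using induction_pure with
    | zero => rw [zero_mul, zero_mul, smul_zero]
    | add x y hx hy => rw [add_mul, smul_add, hx, hy, add_mul]
    | pure r c x =>
      induction y using induction_pure with
      | zero => rw [smul_zero, mul_zero, smul_zero]
      | add x y hx hy => rw [mul_add, smul_add, hx, hy, smul_add, mul_add]
      | pure s d y => rw [smul_pure, pure_mul_pure, pure_mul_pure, smul_pure, mul_smul_comm]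

protected theorem mul_comm (x y : IDR Q) : x * y = y * x := by
  induction x using induction_pure with
  | zero => rw [mul_zero, zero_mul]
  | add x y hx hy => rw [mul_add, add_mul, hx, hy]
  | pure r c x =>
    induction y using induction_pure with
    | zero => rw [mul_zero, zero_mul]
    | add x y hx hy => rw [mul_add, add_mul, hx, hy]
    | pure s d y => rw [pure_mul_pure, pure_mul_pure, mul_comm r, mul_comm c, C₂T.mul_comm]

protected theorem mul_assoc (x y z : IDR Q) : x * y * z = x * (y * z) := by
  induction x using induction_pure with
  | zero => simp only [zero_mul]
  | add x y hx hy => simp only [add_mul, hx, hy]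
  | pure r c x =>
    induction y using induction_pure with
    | zero => simp only [zero_mul, mul_zero]
    | add x y hx hy => simp only [add_mul, mul_add, hx, hy]
    | pure s d y =>
      induction z using induction_pure with
      | zero => simp only [mul_zero]
      | add x y hx hy => simp only [mul_add, hx, hy]
      | pure t e z =>
        rw [pure_mul_pure, pure_mul_pure, pure_mul_pure, pure_mul_pure, mul_assoc r, mul_assoc c,
          C₂T.mul_assoc]

theorem deriv_pure_smul_one (r : R) (c : C₁ Q) (d : C₂ (constants δ) (RT Q)) :
    deriv Q (pure Q r c (d • 1)) = pure Q (δ r) c (d • 1) := by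
  rw [C₂T.one_def, C₂T.smul_mk, ← tmul_eq_pure, deriv_tmul_one, tmul_eq_pure]

theorem deriv_pure_consMap (r : R) (c : C₁ Q) (a : RT Q) (x : C₂T (constants δ) (RT Q)) :
    deriv Q (pure Q r c (C₂T.consMap a x)) =
      pure Q (δ r) c (C₂T.consMap a x) + pure Q (r * a) c x := by
  induction x using C₂T.induction_on with
  | zero => rw [map_zero, pure_zero, pure_zero, pure_zero, map_zero, add_zero]
  | mk d f => rw [C₂T.consMap_mk, ← tmul_eq_pure, deriv_tmul_ι_mul]; rfl
  | add x y hx hy => rw [map_add, pure_add, map_add, hx, hy, pure_add, pure_add]; abel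

set_option maxHeartbeats 1000000 in
theorem deriv_mul (x y : IDR Q) : deriv Q (x * y) = deriv Q x * y + x * deriv Q y := by
  induction x using induction_pure with
  | zero => simp only [zero_mul, map_zero, add_zero]
  | add x y hx hy => simp only [add_mul, map_add, hx, hy]; abel
  | pure r c x =>
  induction y using induction_pure with
  | zero => simp only [mul_zero, map_zero, add_zero]
  | add x y hx hy => simp only [mul_add, map_add, hx, hy]; abel
  | pure s d y =>
  have hδ : δ (r * s) = δ r * s + r * δ s := by
    rw [δ.leibniz, smul_eq_mul, smul_eq_mul]; ring
  induction x using C₂T.induction_cons with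
  | add x x' hx hx' => simp only [pure_add, add_mul, map_add, hx, hx']; abel
  | const e =>
    induction y using C₂T.induction_cons with
    | add x x' hx hx' => simp only [pure_add, mul_add, map_add, hx, hx']; abel
    | const e' =>
      rw [deriv_pure_smul_one, deriv_pure_smul_one, pure_mul_pure, pure_mul_pure, pure_mul_pure,
        smul_mul_assoc, one_mul, smul_smul, deriv_pure_smul_one, hδ, add_pure]
    | cons b y =>
      rw [deriv_pure_smul_one, deriv_pure_consMap, mul_add, pure_mul_pure, pure_mul_pure,
        pure_mul_pure, pure_mul_pure, smul_mul_assoc, smul_mul_assoc, one_mul, one_mul, ← map_smul,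
        deriv_pure_consMap, hδ, add_pure, mul_assoc]
      abel
  | cons a x =>
    induction y using C₂T.induction_cons with
    | add x x' hx hx' => simp only [pure_add, mul_add, map_add, hx, hx']; abel
    | const e' =>
      rw [deriv_pure_smul_one, deriv_pure_consMap, add_mul, pure_mul_pure, pure_mul_pure,
        pure_mul_pure, pure_mul_pure, mul_smul_comm, mul_smul_comm, mul_one, mul_one, ← map_smul,
        deriv_pure_consMap, hδ, add_pure, mul_right_comm]
      abel
    | cons b y =>
      obtain ⟨e, he⟩ := C₂T.exists_consMap_mul_consMap a b x y
      rw [deriv_pure_consMap, deriv_pure_consMap, add_mul, mul_add, pure_mul_pure, pure_mul_pure,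
        pure_mul_pure, pure_mul_pure, pure_mul_pure]
      conv_lhs => rw [he, pure_add, pure_add, map_add, map_add, deriv_pure_consMap,
        deriv_pure_consMap, deriv_pure_smul_one]
      -- The same expansion is needed on the right, with `R`-factors `δ r * s` and `r * δ s`.
      have h : ∀ t : R, pure Q t (c * d) (C₂T.consMap a x * C₂T.consMap b y) =
        pure Q t (c * d) (C₂T.consMap a (x * C₂T.consMap b y)) +
        pure Q t (c * d) (C₂T.consMap b (C₂T.consMap a x * y)) +
        pure Q t (c * d) (e • 1) := fun t => by rw [he, pure_add, pure_add]
      rw [h, h, hδ, add_pure, add_pure, add_pure, mul_right_comm r, mul_assoc r s]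
      abel

theorem tmul_sub_left (r s : R) (c : C₁₂ Q) (f : W Q) :
    tmul Q (r - s) c f = tmul Q r c f - tmul Q s c f :=
  (LinearMap.congr_fun (LinearMap.map_sub₂ (tmul Q) r s c) f :)

theorem tmul_add_left (r s : R) (c : C₁₂ Q) (f : W Q) :
    tmul Q (r + s) c f = tmul Q r c f + tmul Q s c f :=
  (LinearMap.congr_fun (LinearMap.map_add₂ (tmul Q) r s c) f :)

theorem tmul_smul_left (k : constants δ) (r : R) (c : C₁₂ Q) (f : W Q) :
    tmul Q (k • r) c f = k • tmul Q r c f :=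
  (LinearMap.congr_fun (LinearMap.map_smul₂ (tmul Q) k r c) f :)

theorem tmul_zero_left (c : C₁₂ Q) (f : W Q) : tmul Q 0 c f = 0 :=
  (LinearMap.congr_fun (LinearMap.map_zero₂ (tmul Q) c) f :)

theorem tmul_add_mid (r : R) (c d : C₁₂ Q) (f : W Q) :
    tmul Q r (c + d) f = tmul Q r c f + tmul Q r d f :=
  LinearMap.map_add₂ (tmul Q r) c d f

theorem tmul_smul_mid (k : constants δ) (r : R) (c : C₁₂ Q) (f : W Q) :
    tmul Q r (k • c) f = k • tmul Q r c f :=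
  LinearMap.map_smul₂ (tmul Q r) k c f

theorem tmul_zero_mid (r : R) (f : W Q) : tmul Q r 0 f = 0 :=
  LinearMap.map_zero₂ (tmul Q r) f

theorem tmul_add_right (r : R) (c : C₁₂ Q) (f g : W Q) :
    tmul Q r c (f + g) = tmul Q r c f + tmul Q r c g :=
  (tmul Q r c).map_add f g

theorem tmul_smul_right (k : constants δ) (r : R) (c : C₁₂ Q) (f : W Q) :
    tmul Q r c (k • f) = k • tmul Q r c f :=
  (tmul Q r c).map_smul k f

theorem tmul_zero_right (r : R) (c : C₁₂ Q) : tmul Q r c 0 = 0 :=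
  (tmul Q r c).map_zero

theorem eps₁_zero_tmul_mul (f : W Q) (c : C₁₂ Q) :
    (eps₁ Q 0 f ⊗ₜ[constants δ] (1 : C₂ (constants δ) (RT Q))) * c = 0 := by
  have h : eps₁ Q 0 f = 0 := LinearMap.map_zero₂ (eps₁ Q) f
  rw [h, TensorProduct.zero_tmul, zero_mul]

theorem deriv_const (c : C₁₂ Q) : deriv Q (tmul Q 1 c 1) = 0 := by
  rw [deriv_tmul_one, δ.map_one_eq_zero, tmul_zero_left]

theorem deriv_tmul_ι_toRT_mul (r : R) (c : C₁₂ Q) (t : W Q) :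
    deriv Q (tmul Q 1 c (TensorAlgebra.ι _ (Q.toRT r) * t)) =
      tmul Q r c t - tmul Q (δ (Q.toLinearMap r)) c t := by
  rw [deriv_tmul_ι_mul, δ.map_one_eq_zero, tmul_zero_left, zero_add, one_mul, ← tmul_sub_left]
  rfl

theorem deriv_int_tmul (r : R) (c : C₁₂ Q) (f : W Q) :
    deriv Q (int Q (tmul Q r c f)) = tmul Q r c f := by
  -- The recursive term of the integral has coefficient `Q r * a` instead of `r`.
  induction f using word_induction generalizing r with
  | one =>
    have h := deriv_tmul_ι_toRT_mul Q r c 1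
    rw [mul_one] at h
    rw [int_tmul_one, (deriv Q).map_add, (deriv Q).map_sub, deriv_const, deriv_tmul_one, h]
    abel
  | add s t hs ht =>
    rw [tmul_add_right, (int Q).map_add, (deriv Q).map_add, hs, ht]
  | smul k t ht => rw [tmul_smul_right, (int Q).map_smul, (deriv Q).map_smul, ht]
  | cons a t ht =>
    rw [int_tmul_ι_mul, (deriv Q).map_add, (deriv Q).map_sub, (deriv Q).map_sub, deriv_const,
      deriv_tmul_ι_mul, ht, deriv_tmul_ι_toRT_mul]
    abel

theorem deriv_int (x : IDR Q) : deriv Q (int Q x) = x := by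
  induction x using induction_tmul with
  | zero => rw [(int Q).map_zero, (deriv Q).map_zero]
  | tmul r c f => exact deriv_int_tmul Q r c f
  | add x y hx hy => rw [(int Q).map_add, (deriv Q).map_add, hx, hy]

set_option maxHeartbeats 1000000 in
-- Since `Q a = 0`, only the term that prefixes the letter `a - ∂Q a = a` survives. Prefixing a
-- letter of `R_T` is thus genuine integration.
theorem int_tmul_coe_RT (k : R) (hk : δ k = 0) (a : RT Q) (c : C₁₂ Q) (t : W Q) :
    int Q (tmul Q (k * a) c t) = tmul Q k c (TensorAlgebra.ι _ a * t) := by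
  lift k to constants δ using hk
  have h : ((k : R) * a) = k • (a : R) := rfl
  have h' : (k : R) = k • (1 : R) := by simp [Subring.smul_def]
  rw [h, h', tmul_smul_left, tmul_smul_left, (int Q).map_smul]
  congr 1
  have ha : Q.toLinearMap a = 0 := a.2
  induction t using word_induction with
  | one =>
    rw [int_tmul_one, ha, Q.toRT_coe, Q.toRJ_coe, tmul_zero_left, mul_one,
      eps₁_zero_tmul_mul, tmul_zero_mid, sub_zero, zero_add]
  | add s t hs ht =>
    rw [tmul_add_right, (int Q).map_add, hs, ht, mul_add, tmul_add_right]
  | smul r t ht =>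
    rw [tmul_smul_right, (int Q).map_smul, ht, mul_smul_comm, tmul_smul_right]
  | cons b t =>
    rw [int_tmul_ι_mul, ha, Q.toRT_coe, Q.toRJ_coe, tmul_zero_left, zero_mul,
      eps₁_zero_tmul_mul, tmul_zero_mid, sub_zero, tmul_zero_left, (int Q).map_zero, sub_zero,
      zero_add]

theorem int_deriv_tmul_one (r : R) (c : C₁₂ Q) :
    int Q (deriv Q (tmul Q r c 1)) =
      tmul Q r c 1 - tmul Q 1 (Q.toConst r • c + eps₁₂ Q (Q.toRJ (δ r)) 1 * c) 1 := by
  -- The decomposition of `r` along `R = ker δ ⊕ R_J`.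
  have h : Q.toLinearMap (δ r) = r - Q.toConst r • (1 : R) := by
    simp [QuasiIntegration.toConst, Subring.smul_def]
  rw [deriv_tmul_one, int_tmul_one, Q.toRT_deriv, h, tmul_sub_left, tmul_smul_left,
    map_zero (TensorAlgebra.ι _), tmul_zero_right, add_zero, tmul_add_mid, tmul_smul_mid, sub_add_eq_sub_sub]
  rfl

set_option maxHeartbeats 1000000 in
theorem int_deriv_tmul_ι_mul (r : R) (c : C₁₂ Q) (a : RT Q) (t : W Q) :
    int Q (deriv Q (tmul Q r c (TensorAlgebra.ι _ a * t))) =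
      tmul Q r c (TensorAlgebra.ι _ a * t) -
      tmul Q 1 (eps₁₂ Q (Q.toRJ (δ r)) (TensorAlgebra.ι _ a * t) * c) 1 := by
  -- Split `r` into `Q(∂r)` and the constant `r - Q(∂r)`. The first part cancels the recursive term
  -- of `∫(∂r ⊗ c ⊗ (a ⊗ t))`; the second is integrated by prefixing `a`.
  have h : int Q (tmul Q (r * a) c t) = int Q (tmul Q (Q.toLinearMap (δ r) * a) c t) +
      (tmul Q r c (TensorAlgebra.ι _ a * t) -
        tmul Q (Q.toLinearMap (δ r)) c (TensorAlgebra.ι _ a * t)) := by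
    rw [← tmul_sub_left, ← int_tmul_coe_RT Q (r - Q.toLinearMap (δ r)) (Q.toConst r).2,
      ← (int Q).map_add, ← tmul_add_left, ← add_mul, add_sub_cancel]
  rw [deriv_tmul_ι_mul, (int Q).map_add, int_tmul_ι_mul, h, Q.toRT_deriv,
    map_zero (TensorAlgebra.ι _), zero_mul, tmul_zero_right]
  refine Eq.trans ?_ (congrArg (_ - ·) (rfl : tmul Q 1 ((eps₁ Q (Q.toRJ (δ r))
    (TensorAlgebra.ι _ a * t) ⊗ₜ 1) * c) 1 = _))
  abel

theorem const_mul_tmul (c d : C₁₂ Q) (r : R) (f : W Q) :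
    tmul Q 1 c 1 * tmul Q r d f = tmul Q r (c * d) f := by
  induction c using TensorProduct.induction_on with
  | zero => rw [tmul_zero_mid, zero_mul, zero_mul, tmul_zero_mid]
  | add c c' hc hc' => rw [tmul_add_mid, add_mul, hc, hc', add_mul,
      tmul_add_mid]
  | tmul c₁ c₂ =>
    induction d using TensorProduct.induction_on with
    | zero => rw [tmul_zero_mid, mul_zero, mul_zero,
        tmul_zero_mid]
    | add c c' hc hc' => rw [tmul_add_mid, mul_add, hc, hc', mul_add,
        tmul_add_mid]
    | tmul d₁ d₂ =>
      have h : (C₂T.mk c₂ 1 * C₂T.mk d₂ f : C₂T (constants δ) (RT Q)) = C₂T.mk (c₂ * d₂) f := by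
        rw [C₂T.mk_mul_mk, ← C₂T.one_def, one_mul, C₂T.smul_mk, mul_one]
      rw [Algebra.TensorProduct.tmul_mul_tmul, tmul_eq_pure, tmul_eq_pure, pure_mul_pure, h,
        one_mul, tmul_eq_pure]

set_option maxHeartbeats 1000000 in
theorem int_const_mul_tmul (c d : C₁₂ Q) (r : R) (f : W Q) :
    int Q (tmul Q r (c * d) f) = tmul Q 1 c 1 * int Q (tmul Q r d f) := by
  induction f using word_induction generalizing r with
  | one =>
    rw [int_tmul_one, int_tmul_one, mul_add, mul_sub, const_mul_tmul, const_mul_tmul,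
      const_mul_tmul, mul_left_comm]
  | add s t hs ht =>
    rw [tmul_add_right, (int Q).map_add, hs, ht, tmul_add_right, (int Q).map_add,
      mul_add]
  | smul k t ht =>
    rw [tmul_smul_right, (int Q).map_smul, ht, tmul_smul_right, (int Q).map_smul,
      mul_smul_comm]
  | cons a t ht =>
    rw [int_tmul_ι_mul, int_tmul_ι_mul, mul_add, mul_sub, mul_sub, const_mul_tmul, const_mul_tmul,
      const_mul_tmul, mul_left_comm, ht]

theorem int_const_mul (c : C₁₂ Q) (x : IDR Q) :
    int Q (tmul Q 1 c 1 * x) = tmul Q 1 c 1 * int Q x := by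
  induction x using induction_tmul with
  | zero => rw [mul_zero, (int Q).map_zero, mul_zero]
  | tmul r d f => rw [const_mul_tmul, int_const_mul_tmul]
  | add x y hx hy => rw [mul_add, (int Q).map_add, hx, hy, (int Q).map_add, mul_add]

/-- This identifies the constants of `IDR(R)`: if `∂x = 0`, then `x` is the image of an element of
`C₁ ⊗ C₂`. -/
theorem exists_int_deriv (x : IDR Q) : ∃ c : C₁₂ Q, x = int Q (deriv Q x) + tmul Q 1 c 1 := by
  have h : ∀ f r c, ∃ c' : C₁₂ Q,
      tmul Q r c f = int Q (deriv Q (tmul Q r c f)) + tmul Q 1 c' 1 := fun f r c => by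
    induction f using word_induction with
    | one => exact ⟨_, by rw [int_deriv_tmul_one, sub_add_cancel]⟩
    | add s t hs ht =>
      obtain ⟨a, ha⟩ := hs
      obtain ⟨b, hb⟩ := ht
      refine ⟨a + b, ?_⟩
      rw [tmul_add_mid, tmul_add_right, (deriv Q).map_add,
        (int Q).map_add, add_add_add_comm, ← ha, ← hb]
    | smul k t ht =>
      obtain ⟨a, ha⟩ := ht
      refine ⟨k • a, ?_⟩
      rw [tmul_smul_mid, tmul_smul_right, (deriv Q).map_smul,
        (int Q).map_smul, ← smul_add, ← ha]
    | cons a t => exact ⟨_, by rw [int_deriv_tmul_ι_mul, sub_add_cancel]⟩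
  induction x using induction_tmul with
  | zero => exact ⟨0, by
      rw [tmul_zero_mid, (deriv Q).map_zero, (int Q).map_zero, zero_add]⟩
  | tmul r c f => exact h f r c
  | add x y hx hy =>
    obtain ⟨a, ha⟩ := hx
    obtain ⟨b, hb⟩ := hy
    refine ⟨a + b, ?_⟩
    rw [tmul_add_mid, (deriv Q).map_add, (int Q).map_add,
      add_add_add_comm, ← ha, ← hb]

theorem isIntegroDifferential : IsIntegroDifferential (deriv Q) (int Q) := by
  have h : ∀ c f, deriv Q c = 0 → int Q (c * f) = c * int Q f := fun c f hc => by
    obtain ⟨c', hc'⟩ := exists_int_deriv Q c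
    rw [hc, (int Q).map_zero, zero_add] at hc'
    rw [hc', int_const_mul]
  exact
    { deriv_add := (deriv Q).map_add
      deriv_mul := deriv_mul Q
      int_add := (int Q).map_add
      int_const_mul := h
      int_mul_const := fun c f hc => by
        rw [IDR.mul_comm, h c f hc, IDR.mul_comm]
      deriv_int := deriv_int Q }

/-- The retraction `f ⊗ c ⊗ x ↦ (aug c) (aug x) f` of `ι`. -/
def aug : IDR Q →ₗ[constants δ] R :=
  TensorProduct.lift (LinearMap.lsmul (constants δ) R ∘ₗ
    LinearMap.mul' (constants δ) (constants δ) ∘ₗ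
      TensorProduct.map (SymmetricAlgebra.algebraMapInv (R := constants δ)
        (M := RJ Q ⊗[constants δ] W Q)).toLinearMap C₂T.aug).flip

theorem aug_ι (f : R) : aug Q (ι Q f) = f := by
  change (SymmetricAlgebra.algebraMapInv (R := constants δ) (M := RJ Q ⊗[constants δ] W Q) 1 *
    C₂T.aug (1 : C₂T (constants δ) (RT Q))) • f = f
  rw [map_one, C₂T.aug_one, one_mul, one_smul]

theorem ι_injective : Function.Injective (ι Q) :=
  Function.LeftInverse.injective (aug_ι Q)

theorem deriv_ι (f : R) : deriv Q (ι Q f) = ι Q (δ f) := deriv_tmul_one Q f 1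

end IDR
end IDR

/-! ### Generators of `C₁` and `C₂`. -/

section Evaluations

variable {C : Type*} [CommRing C] {M : Type*} [AddCommGroup M] [Module C M]

instance : IsScalarTower C (C₂ C M) (C₂T C M) :=
  inferInstanceAs (IsScalarTower C (C₂ C M) (C₂ C M ⊗[C] T C M))

theorem tildeProj_subtype (f : Ttilde C M) :
    tildeProj ((tildeSubmodule C M).subtype f) = f := by
  refine (tildeSubmodule C M).injective_subtype ((subtype_tildeProj _).trans ?_)
  have h : TensorAlgebra.algebraMapInv ((tildeSubmodule C M).subtype f) = 0 := f.2
  rw [h, map_zero, sub_zero]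

/-- `Sym(ε(M₂))` is generated by the `ε(f ⊙ g)`. -/
theorem symmetricAlgebra_M₂_induction {p : SymmetricAlgebra C (M₂ C M) → Prop}
    (smul_one : ∀ k : C, p (k • 1)) (eps : ∀ f g : T C M, p (preEps₂ f g))
    (mul : ∀ c d, p c → p d → p (c * d)) (add : ∀ c d, p c → p d → p (c + d))
    (c : SymmetricAlgebra C (M₂ C M)) : p c := by
  induction c using SymmetricAlgebra.induction with
  | algebraMap k => rw [Algebra.algebraMap_eq_smul_one]; exact smul_one k
  | ι m =>
    obtain ⟨t, rfl⟩ : ∃ t, M₂.mk C M t = m := Submodule.mkQ_surjective _ m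
    induction t using TensorProduct.induction_on with
    | zero => rw [map_zero, map_zero, ← zero_smul C]; exact smul_one 0
    | tmul f g =>
      have h := eps ((tildeSubmodule C M).subtype f) ((tildeSubmodule C M).subtype g)
      rw [preEps₂, LinearMap.compr₂_apply, LinearMap.compl₁₂_apply, tildeProj_subtype,
        tildeProj_subtype] at h
      exact h
    | add x y hx hy => rw [map_add, map_add]; exact add _ _ hx hy
  | mul c d hc hd => exact mul c d hc hd
  | add c d hc hd => exact add c d hc hd

theorem C₂.induction {p : C₂ C M → Prop}
    (smul_one : ∀ k : C, p (k • 1)) (eps : ∀ f g : T C M, p (eps₂ f g))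
    (mul : ∀ c d, p c → p d → p (c * d)) (add : ∀ c d, p c → p d → p (c + d))
    (c : C₂ C M) : p c := by
  obtain ⟨c, rfl⟩ := Ideal.Quotient.mk_surjective c
  exact symmetricAlgebra_M₂_induction (p := fun c => p (C₂.proj C M c))
    (fun k => by rw [map_smul, map_one]; exact smul_one k) eps
    (fun c d hc hd => by rw [map_mul]; exact mul _ _ hc hd)
    (fun c d hc hd => by rw [map_add]; exact add _ _ hc hd) c

theorem C₁.induction {R : Type*} [CommRing R] {δ : Derivation ℤ R R} {Q : QuasiIntegration δ}
    {p : C₁ Q → Prop} (smul_one : ∀ k : constants δ, p (k • 1)) (eps : ∀ q f, p (eps₁ Q q f))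
    (mul : ∀ c d, p c → p d → p (c * d)) (add : ∀ c d, p c → p d → p (c + d))
    (c : C₁ Q) : p c := by
  refine @SymmetricAlgebra.induction (constants δ) (RJ Q ⊗[constants δ] W Q) _ _ _ p (fun k => ?_) (fun m => ?_) mul add c
  · rw [Algebra.algebraMap_eq_smul_one]; exact smul_one k
  · induction m using TensorProduct.induction_on with
    | zero => rw [map_zero, ← zero_smul (constants δ)]; exact smul_one 0
    | tmul q f => exact eps q f
    | add x y hx hy => rw [map_add]; exact add _ _ hx hy

end Evaluations

/-! ## Generation of `IDR(R)` -/

section Generation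

variable {R : Type*} [CommRing R] {δ : Derivation ℤ R R} (Q : QuasiIntegration δ)

namespace IDR

theorem one_eq_pure : (1 : IDR Q) = pure Q 1 1 1 := rfl

theorem ι_eq_pure (f : R) : ι Q f = pure Q f 1 1 := rfl

theorem smul_eq_ι_mul (k : constants δ) (x : IDR Q) : k • x = ι Q k * x := by
  induction x using induction_pure with
  | zero => rw [smul_zero, mul_zero]
  | add x y hx hy => rw [smul_add, hx, hy, mul_add]
  | pure r c x =>
    rw [smul_pure, ι_eq_pure, pure_mul_pure, one_mul, one_mul]
    rfl

theorem pure_smul_right (k : constants δ) (r : R) (c : C₁ Q) (x : C₂T (constants δ) (RT Q)) :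
    pure Q r c (k • x) = k • pure Q r c x :=
  (congrArg (r ⊗ₜ[constants δ] ·) (TensorProduct.tmul_smul k c x)).trans
    (TensorProduct.tmul_smul k r _)

theorem pure_smul_mid (k : constants δ) (r : R) (c : C₁ Q) (x : C₂T (constants δ) (RT Q)) :
    pure Q r (k • c) x = k • pure Q r c x :=
  TensorProduct.tmul_smul k r (c ⊗ₜ[constants δ] x)

theorem pure_add_mid (r : R) (c d : C₁ Q) (x : C₂T (constants δ) (RT Q)) :
    pure Q r (c + d) x = pure Q r c x + pure Q r d x :=
  (congrArg (r ⊗ₜ[constants δ] ·) (TensorProduct.add_tmul c d x)).trans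
    (TensorProduct.tmul_add r _ _)

theorem int_pure_coe_RT (a : RT Q) (c : C₁ Q) (x : C₂T (constants δ) (RT Q)) :
    int Q (pure Q a c x) = pure Q 1 c (C₂T.consMap a x) := by
  induction x using C₂T.induction_on with
  | zero => rw [map_zero, pure_zero, pure_zero, map_zero]
  | add x y hx hy => rw [map_add, pure_add, pure_add, map_add, hx, hy]
  | mk d f =>
    have h := int_tmul_coe_RT Q 1 δ.map_one_eq_zero a (c ⊗ₜ d) f
    rw [one_mul] at h
    exact h

theorem int_deriv_pure_consMap (a : RT Q) (c : C₁ Q) (x : C₂T (constants δ) (RT Q)) :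
    int Q (deriv Q (pure Q 1 c (C₂T.consMap a x))) = pure Q 1 c (C₂T.consMap a x) := by
  have h : pure Q 0 c (C₂T.consMap a x) = 0 := TensorProduct.zero_tmul _ _
  rw [deriv_pure_consMap, δ.map_one_eq_zero, h, zero_add, one_mul, int_pure_coe_RT]

set_option maxHeartbeats 1000000 in
-- Realises the generators of `C₁` as evaluations inside `IDR(R)`, hence as elements generated by
-- `R` and words.
theorem sub_int_deriv_tmul (q : RJ Q) (f : W Q) :
    tmul Q (q : R) 1 f - int Q (deriv Q (tmul Q (q : R) 1 f)) = tmul Q 1 (eps₁₂ Q q f) 1 := by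
  induction f using word_induction with
  | one =>
    -- An element of `R_J` has no component in the constants, since `Q ∂ Q = Q`.
    have h : Q.toConst (q : R) = 0 :=
      Subtype.ext (sub_eq_zero.2 (congrArg Subtype.val (Q.toRJ_deriv q)).symm)
    rw [int_deriv_tmul_one, Q.toRJ_deriv, h, zero_smul, zero_add, mul_one, sub_sub_cancel]
  | add s t hs ht =>
    rw [tmul_add_right, (eps₁₂ Q q).map_add, tmul_add_mid, ← hs, ← ht, (deriv Q).map_add,
      (int Q).map_add, add_sub_add_comm]
  | smul k t ht =>
    rw [tmul_smul_right, (eps₁₂ Q q).map_smul, tmul_smul_mid, ← ht, (deriv Q).map_smul,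
      (int Q).map_smul, smul_sub]
  | cons a t => rw [int_deriv_tmul_ι_mul, Q.toRJ_deriv, mul_one, sub_sub_cancel]

set_option maxHeartbeats 1000000 in
-- The first two terms of the product recursion are integrals, so `id - ∫∂` kills them and retains
-- the constant. This exhibits the generators of `C₂`.
theorem sub_int_deriv_mul (a b : RT Q) (s t : W Q) :
    pure Q 1 1 (C₂T.mk 1 (TensorAlgebra.ι _ a * s)) *
        pure Q 1 1 (C₂T.mk 1 (TensorAlgebra.ι _ b * t)) -
      int Q (deriv Q (pure Q 1 1 (C₂T.mk 1 (TensorAlgebra.ι _ a * s)) *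
        pure Q 1 1 (C₂T.mk 1 (TensorAlgebra.ι _ b * t)))) =
      pure Q 1 1 (eps₂ (TensorAlgebra.ι _ a * s) (TensorAlgebra.ι _ b * t) • 1) := by
  have h : ∀ x, pure Q 0 1 x = 0 := fun x => TensorProduct.zero_tmul _ _
  rw [pure_mul_pure, one_mul, one_mul, C₂T.mk_cons_mul_mk_cons, pure_add, pure_add,
    (deriv Q).map_add, (deriv Q).map_add, (int Q).map_add, (int Q).map_add,
    int_deriv_pure_consMap, int_deriv_pure_consMap, deriv_pure_smul_one, δ.map_one_eq_zero, h,
    (int Q).map_zero, add_zero, add_sub_cancel_left]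

variable {Q} in
/-- `IDR(R)` is generated by `R` as an integro-differential ring. -/
theorem induction_generated {p : IDR Q → Prop} (hι : ∀ f, p (ι Q f))
    (hadd : ∀ x y, p x → p y → p (x + y)) (hmul : ∀ x y, p x → p y → p (x * y))
    (hd : ∀ x, p x → p (deriv Q x)) (hJ : ∀ x, p x → p (int Q x)) (x : IDR Q) : p x := by
  have hneg : ∀ x, p x → p (-x) := fun x hx => by
    have h := hmul _ _ (hι (-1)) hx
    rwa [map_neg, map_one, neg_mul, one_mul] at h
  have hsub : ∀ x y, p x → p y → p (x - y) := fun x y hx hy => by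
    rw [sub_eq_add_neg]; exact hadd _ _ hx (hneg _ hy)
  have hzero : p 0 := by rw [← map_zero (ι Q)]; exact hι 0
  have hsmul : ∀ (k : constants δ) x, p x → p (k • x) := fun k x hx => by
    rw [smul_eq_ι_mul]; exact hmul _ _ (hι _) hx
  have hword : ∀ f, p (pure Q 1 1 (C₂T.mk 1 f)) := fun f => by
    induction f using word_induction with
    | one => exact hι 1
    | add s t hs ht => rw [map_add, pure_add]; exact hadd _ _ hs ht
    | smul k t ht => rw [map_smul, pure_smul_right]; exact hsmul k _ ht
    | cons a t ht =>
      -- A word is the integral of its first letter times the remaining word.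
      rw [← C₂T.consMap_mk, ← int_pure_coe_RT]
      have h := hmul _ _ (hι a) ht
      rw [ι_eq_pure, pure_mul_pure, mul_one, one_mul, one_mul] at h
      exact hJ _ h
  have h₁ : ∀ c, p (pure Q 1 c 1) := fun c => by
    induction c using C₁.induction with
    | smul_one k => rw [pure_smul_mid]; exact hsmul k _ (hι 1)
    | eps q f =>
      have h : p (tmul Q (q : R) 1 f) := by
        have h := hmul _ _ (hι q) (hword f)
        rwa [ι_eq_pure, pure_mul_pure, mul_one, one_mul, one_mul] at h
      have h' := hsub _ _ h (hJ _ (hd _ h))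
      rwa [sub_int_deriv_tmul] at h'
    | mul c d hc hd =>
      have h := hmul _ _ hc hd
      rwa [pure_mul_pure, one_mul, one_mul] at h
    | add c d hc hd => rw [pure_add_mid]; exact hadd _ _ hc hd
  have hε : ∀ f g : W Q, p (pure Q 1 1 (eps₂ f g • 1)) := fun f g => by
    induction f using word_induction with
    | one => rw [C₂T.eps₂_one_left, zero_smul, pure_zero]; exact hzero
    | add s t hs ht => rw [LinearMap.map_add₂, add_smul, pure_add]; exact hadd _ _ hs ht
    | smul k t ht => rw [LinearMap.map_smul₂, smul_assoc, pure_smul_right]; exact hsmul _ _ ht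
    | cons a s ih =>
      clear ih
      induction g using word_induction with
      | one => rw [C₂T.eps₂_one_right, zero_smul, pure_zero]; exact hzero
      | add s t hs ht => rw [map_add, add_smul, pure_add]; exact hadd _ _ hs ht
      | smul k t ht => rw [map_smul, smul_assoc, pure_smul_right]; exact hsmul _ _ ht
      | cons b t =>
        rw [← sub_int_deriv_mul]
        have h := hmul _ _ (hword (TensorAlgebra.ι _ a * s)) (hword (TensorAlgebra.ι _ b * t))
        exact hsub _ _ h (hJ _ (hd _ h))
  have h₂ : ∀ c : C₂ (constants δ) (RT Q), p (pure Q 1 1 (c • 1)) := fun c => by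
    induction c using C₂.induction with
    | smul_one k => rw [smul_assoc, one_smul, pure_smul_right]; exact hsmul k _ (hι 1)
    | eps f g => exact hε f g
    | mul c d hc hd =>
      have h := hmul _ _ hc hd
      rwa [pure_mul_pure, one_mul, one_mul, smul_mul_assoc, one_mul, smul_smul] at h
    | add c d hc hd => rw [add_smul, pure_add]; exact hadd _ _ hc hd
  induction x using induction_pure with
  | zero => exact hzero
  | add x y hx hy => exact hadd _ _ hx hy
  | pure r c x =>
    have hx : p (pure Q 1 1 x) := by
      induction x using C₂T.induction_on with
      | zero => rw [pure_zero]; exact hzero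
      | add x y hx hy => rw [pure_add]; exact hadd _ _ hx hy
      | mk d f =>
        have h := hmul _ _ (h₂ d) (hword f)
        rwa [pure_mul_pure, one_mul, one_mul, smul_mul_assoc, one_mul, C₂T.smul_mk, mul_one] at h
    have h := hmul _ _ (hι r) (hmul _ _ (h₁ c) hx)
    rwa [ι_eq_pure, pure_mul_pure, pure_mul_pure, one_mul, mul_one, one_mul, mul_one, one_mul,
      one_mul]
      at h

end IDR
end Generation

/-! ## Integro-differential rings -/

namespace IsIntegroDifferential

variable {C : Type*} [CommRing C] {S : Type*} [CommRing S] [Algebra C S] {d J : S →ₗ[C] S}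

theorem deriv_one (h : IsIntegroDifferential d J) : d 1 = 0 := by
  have h₁ := h.deriv_mul 1 1
  rw [mul_one, mul_one, one_mul] at h₁
  exact left_eq_add.1 h₁

theorem deriv_mul_eq_zero (h : IsIntegroDifferential d J) {x y : S} (hx : d x = 0)
    (hy : d y = 0) : d (x * y) = 0 := by
  rw [h.deriv_mul, hx, hy, zero_mul, mul_zero, add_zero]

end IsIntegroDifferential

/-! ### The evaluation and integration by parts. -/

section Evaluation

variable {C : Type*} [CommRing C] {S : Type*} [CommRing S] [Algebra C S] (d J : S →ₗ[C] S)

/-- The evaluation `id - ∫ ∂`. -/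
def evaluation : S →ₗ[C] S := LinearMap.id - J ∘ₗ d

variable {d J}

theorem evaluation_apply (x : S) : evaluation d J x = x - J (d x) := rfl

theorem deriv_evaluation (h : IsIntegroDifferential d J) (x : S) : d (evaluation d J x) = 0 := by
  rw [evaluation_apply, map_sub, h.deriv_int, sub_self]

theorem evaluation_int (h : IsIntegroDifferential d J) (x : S) : evaluation d J (J x) = 0 := by
  rw [evaluation_apply, h.deriv_int, sub_self]

theorem evaluation_const_mul (h : IsIntegroDifferential d J) {c : S} (hc : d c = 0) (x : S) :
    evaluation d J (c * x) = c * evaluation d J x := by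
  rw [evaluation_apply, h.deriv_mul, hc, zero_mul, zero_add, h.int_const_mul c _ hc,
    evaluation_apply, mul_sub]

/-- Split `r = d q + (r - d q)` and integrate `d q * w` by parts. With `q` the image of `Q f₀` and
`w` a nested integral, this is the recursion defining `∫` on `IDR(R)`. -/
theorem int_by_parts (h : IsIntegroDifferential d J) {c : S} (hc : d c = 0) (r q w : S) :
    q * (c * w) - c * evaluation d J (q * w) - J (c * (q * d w)) + c * J ((r - d q) * w) =
      J (c * (r * w)) := by
  rw [h.int_const_mul c _ hc, h.int_const_mul c _ hc, evaluation_apply, h.deriv_mul, map_add,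
    sub_mul, map_sub]
  ring

end Evaluation

/-! ## Nested integrals -/

section NestedIntegrals

variable {C : Type*} [CommRing C] {M : Type*} [AddCommGroup M] [Module C M]
  {S : Type*} [CommRing S] [Algebra C S] (d J : S →ₗ[C] S) (p : M →ₗ[C] S)

/-- The nested integral `f₁ ⊗ ⋯ ⊗ fₙ ↦ ∫ p(f₁) ∫ p(f₂) ⋯ ∫ p(fₙ)`. -/
def nestedInt : T C M →ₗ[C] S := wordRec 1 0 ((LinearMap.mul C S ∘ₗ p).compr₂ J)

theorem nestedInt_one : nestedInt J p 1 = 1 := by simp [nestedInt]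

theorem nestedInt_ι_mul (a : M) (t : T C M) :
    nestedInt J p (TensorAlgebra.ι C a * t) = J (p a * nestedInt J p t) := by simp [nestedInt]

/-- `(f, g) ↦ E(f g)` on nested integrals. -/
def evalPairing : Ttilde C M →ₗ[C] Ttilde C M →ₗ[C] S :=
  ((LinearMap.mul C S).compl₁₂ (nestedInt J p ∘ₗ (tildeSubmodule C M).subtype)
    (nestedInt J p ∘ₗ (tildeSubmodule C M).subtype)).compr₂ (evaluation d J)

/-- The homomorphism `Sym(ε(M₂)) → S`, `ε(f ⊙ g) ↦ E(f g)`. -/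
def preLift₂ : SymmetricAlgebra C (M₂ C M) →ₐ[C] S :=
  SymmetricAlgebra.lift <| Submodule.liftQ _ (TensorProduct.lift (evalPairing d J p)) <| by
    rw [Submodule.span_le]
    rintro _ ⟨f, g, rfl⟩
    rw [SetLike.mem_coe, LinearMap.mem_ker, map_sub, sub_eq_zero, TensorProduct.lift.tmul,
      TensorProduct.lift.tmul]
    exact congrArg (evaluation d J) (mul_comm _ _)

theorem preLift₂_preEps₂ (f g : T C M) : preLift₂ d J p (preEps₂ f g) =
    evaluation d J (nestedInt J p ((tildeSubmodule C M).subtype (tildeProj f)) *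
      nestedInt J p ((tildeSubmodule C M).subtype (tildeProj g))) :=
  SymmetricAlgebra.lift_ι_apply _ _

variable {d J p}

/-- The degree-zero part of `f`, ignored by `ε`, contributes a multiple of `E(∫ ⋯) = 0`. One
argument must start with a letter: for two empty words `ε` gives `0`, whereas `E(1) = 1`. -/
theorem preLift₂_preEps₂_cons (h : IsIntegroDifferential d J) (f : T C M) (b : M) (t : T C M) :
    preLift₂ d J p (preEps₂ f (TensorAlgebra.ι C b * t)) =
      evaluation d J (nestedInt J p f * nestedInt J p (TensorAlgebra.ι C b * t)) := by
  rw [preLift₂_preEps₂, subtype_tildeProj, subtype_tildeProj]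
  have h₁ : TensorAlgebra.algebraMapInv (TensorAlgebra.ι C b * t) = 0 := by
    simp [TensorAlgebra.algebraMapInv]
  rw [h₁, map_zero, sub_zero, map_sub, sub_mul, map_sub, Algebra.algebraMap_eq_smul_one,
    map_smul, nestedInt_one, nestedInt_ι_mul, smul_mul_assoc, one_mul, map_smul,
    evaluation_int h, smul_zero, sub_zero]

theorem deriv_preLift₂ (h : IsIntegroDifferential d J) (c : SymmetricAlgebra C (M₂ C M)) : d (preLift₂ d J p c) = 0 := by
  induction c using symmetricAlgebra_M₂_induction with
  | smul_one k => rw [map_smul, map_smul, map_one, h.deriv_one, smul_zero]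
  | eps f g => rw [preLift₂_preEps₂, deriv_evaluation h]
  | mul a b ha hb => rw [map_mul, h.deriv_mul_eq_zero ha hb]
  | add a b ha hb => rw [map_add, map_add, ha, hb, add_zero]

section

variable {A : Type*} [CommRing A] [Algebra C A] (θ : A →ₐ[C] S)

variable (J p) in
/-- `a ⊗ f ↦ θ(a) ∫ f`, where `∫ f` is the nested integral. -/
def constNestedInt : A ⊗[C] T C M →ₗ[C] S :=
  LinearMap.mul' C S ∘ₗ TensorProduct.map θ.toLinearMap (nestedInt J p)

theorem constNestedInt_tmul (a : A) (t : T C M) :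
    constNestedInt J p θ (a ⊗ₜ t) = θ a * nestedInt J p t := rfl

variable {θ} {e : T C M →ₗ[C] T C M →ₗ[C] A}

theorem constNestedInt_lTensor_cons (h : IsIntegroDifferential d J) (hθ : ∀ a, d (θ a) = 0)
    (m : M) (x : A ⊗[C] T C M) :
    constNestedInt J p θ ((cons m).lTensor A x) = J (p m * constNestedInt J p θ x) := by
  induction x using TensorProduct.induction_on with
  | zero => simp only [map_zero, mul_zero]
  | tmul a t =>
    rw [LinearMap.lTensor_tmul, constNestedInt_tmul, constNestedInt_tmul, cons_apply,
      nestedInt_ι_mul, mul_left_comm, h.int_const_mul _ _ (hθ a)]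
  | add x y hx hy => simp only [map_add, hx, hy, mul_add]

/-- Both sides obey the same recursion, by `x = J (d x) + E x` and the Leibniz rule. The coefficient
algebra is left general: `Sym(ε(M₂))` is needed to show that the relations are respected, and `C₂`
to obtain the final homomorphism. -/
theorem constNestedInt_twistedShuffle (h : IsIntegroDifferential d J) (hθ : ∀ a, d (θ a) = 0)
    (h₁ : ∀ f, e f 1 = 0) (hc : ∀ f g, e f g = e g f)
    (he : ∀ f b t, θ (e f (TensorAlgebra.ι C b * t)) =
      evaluation d J (nestedInt J p f * nestedInt J p (TensorAlgebra.ι C b * t))) (f g : T C M) :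
    constNestedInt J p θ (twistedShuffle e f g) = nestedInt J p f * nestedInt J p g := by
  suffices hs : (twistedShuffle e).compr₂ (constNestedInt J p θ) =
      (LinearMap.mul C S).compl₁₂ (nestedInt J p) (nestedInt J p) from
    congrArg (fun F => F f g) hs
  refine linearMap_ext_word₂ fun f => ?_
  have hone : ∀ f, constNestedInt J p θ (twistedShuffle e f 1) = nestedInt J p f := fun f => by
    rw [twistedShuffle_one_right h₁, constNestedInt_tmul, map_one, one_mul]
  simp only [LinearMap.compr₂_apply, LinearMap.compl₁₂_apply, LinearMap.mul_apply_apply]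
  induction f with
  | nil => intro g; rw [word_nil, twistedShuffle_comm hc, hone, nestedInt_one, one_mul]
  | cons a f hf =>
    intro g
    induction g with
    | nil => rw [word_nil, hone, nestedInt_one, mul_one]
    | cons b g hg =>
      have hf := hf (b :: g)
      simp only [word_cons] at hf hg ⊢
      rw [twistedShuffle_ι_mul_ι_mul, map_add, map_add, constNestedInt_lTensor_cons h hθ,
        constNestedInt_lTensor_cons h hθ, hf, hg, constNestedInt_tmul, he, nestedInt_one, mul_one,
        evaluation_apply, h.deriv_mul, nestedInt_ι_mul, nestedInt_ι_mul, h.deriv_int, h.deriv_int,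
        mul_assoc, mul_left_comm (p b), map_add]
      abel

theorem map_evalRight (h : IsIntegroDifferential d J) (hθ : ∀ a, d (θ a) = 0)
    (he : ∀ f b t, θ (e f (TensorAlgebra.ι C b * t)) =
      evaluation d J (nestedInt J p f * nestedInt J p (TensorAlgebra.ι C b * t)))
    (b : M) (t : T C M) (x : A ⊗[C] T C M) :
    θ (evalRight e (TensorAlgebra.ι C b * t) x) =
      evaluation d J (constNestedInt J p θ x * nestedInt J p (TensorAlgebra.ι C b * t)) := by
  induction x using TensorProduct.induction_on with
  | zero => simp only [map_zero, zero_mul]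
  | tmul a s =>
    rw [evalRight_tmul, map_mul, he, constNestedInt_tmul, mul_assoc,
      evaluation_const_mul h (hθ a)]
  | add x y hx hy => rw [map_add, map_add, hx, hy, map_add, add_mul, map_add]

end

/-- Both halves of the relation evaluate the same triple product of nested integrals in `S`, which
is associative and commutative. -/
theorem preLift₂_evalRel (h : IsIntegroDifferential d J) (k f g : List M) (hk : k ≠ [])
    (hg : g ≠ []) : preLift₂ d J p (evalRel k f g) = 0 := by
  obtain ⟨a, k, rfl⟩ := List.exists_cons_of_ne_nil hk
  obtain ⟨b, g, rfl⟩ := List.exists_cons_of_ne_nil hg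
  have hr := map_evalRel (AlgHom.id C _) (a :: k) f (b :: g)
  have he : (preEps₂ : T C M →ₗ[C] T C M →ₗ[C] _).compr₂
      (AlgHom.id C (SymmetricAlgebra C (M₂ C M))).toLinearMap = preEps₂ := rfl
  rw [he, AlgHom.id_apply] at hr
  have heval : ∀ (c : M) (l : List M) (x : SymmetricAlgebra C (M₂ C M) ⊗[C] T C M),
      preLift₂ d J p (evalRight preEps₂ (word C (c :: l)) x) =
        evaluation d J (constNestedInt J p (preLift₂ d J p) x * nestedInt J p (word C (c :: l))) :=
    fun c l x => by
      rw [word_cons]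
      exact map_evalRight h (deriv_preLift₂ h) (preLift₂_preEps₂_cons h) c (word C l) x
  have hmul := constNestedInt_twistedShuffle (p := p) h (deriv_preLift₂ h) preEps₂_one_right
    preEps₂_comm (preLift₂_preEps₂_cons h)
  rw [hr, map_sub, heval, heval, hmul, hmul, sub_eq_zero]
  congr 1
  ring

/-- The homomorphism `C₂ → S`, `ε(f ⊙ g) ↦ E(f g)`. -/
def lift₂ (h : IsIntegroDifferential d J) (p : M →ₗ[C] S) : C₂ C M →ₐ[C] S :=
  Ideal.Quotient.liftₐ (J₂ C M) (preLift₂ d J p) fun x hx => by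
    suffices hs : J₂ C M ≤ RingHom.ker (preLift₂ d J p) from hs hx
    refine Ideal.span_le.2 ?_
    rintro _ ⟨f, g, k, hf, -, hk, rfl⟩
    exact preLift₂_evalRel h f g k hf hk

theorem lift₂_eps₂ (h : IsIntegroDifferential d J) (f g : T C M) :
    lift₂ h p (eps₂ f g) = preLift₂ d J p (preEps₂ f g) := rfl

theorem lift₂_eps₂_cons (h : IsIntegroDifferential d J) (f : T C M) (b : M) (t : T C M) :
    lift₂ h p (eps₂ f (TensorAlgebra.ι C b * t)) =
      evaluation d J (nestedInt J p f * nestedInt J p (TensorAlgebra.ι C b * t)) := by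
  rw [lift₂_eps₂, preLift₂_preEps₂_cons h]

theorem deriv_lift₂ (h : IsIntegroDifferential d J) (c : C₂ C M) : d (lift₂ h p c) = 0 := by
  obtain ⟨c, rfl⟩ := Ideal.Quotient.mk_surjective c
  exact deriv_preLift₂ h c

/-- The homomorphism `C₂ ⊗ T(M) → S`, `c ⊗ f ↦ c ∫ f`, where `∫ f` is the nested integral. -/
def liftC₂T (h : IsIntegroDifferential d J) (p : M →ₗ[C] S) : C₂T C M →ₗ[C] S :=
  constNestedInt J p (lift₂ h p)

theorem liftC₂T_mk (h : IsIntegroDifferential d J) (c : C₂ C M) (f : T C M) :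
    liftC₂T h p (C₂T.mk c f) = lift₂ h p c * nestedInt J p f := rfl

theorem liftC₂T_smul (h : IsIntegroDifferential d J) (c : C₂ C M) (x : C₂T C M) :
    liftC₂T h p (c • x) = lift₂ h p c * liftC₂T h p x := by
  induction x using C₂T.induction_on with
  | zero => rw [smul_zero, map_zero, mul_zero]
  | mk d f => rw [C₂T.smul_mk, liftC₂T_mk, liftC₂T_mk, map_mul, mul_assoc]
  | add x y hx hy => rw [smul_add, map_add, hx, hy, map_add, mul_add]

theorem liftC₂T_one (h : IsIntegroDifferential d J) : liftC₂T h p 1 = 1 := by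
  rw [C₂T.one_def, liftC₂T_mk, map_one, nestedInt_one, mul_one]

theorem liftC₂T_mul (h : IsIntegroDifferential d J) (x y : C₂T C M) :
    liftC₂T h p (x * y) = liftC₂T h p x * liftC₂T h p y := by
  induction x using C₂T.induction_on with
  | zero => rw [zero_mul, map_zero, zero_mul]
  | add x y hx hy => rw [add_mul, map_add, hx, hy, map_add, add_mul]
  | mk c f =>
    induction y using C₂T.induction_on with
    | zero => rw [mul_zero, map_zero, mul_zero]
    | add x y hx hy => rw [mul_add, map_add, hx, hy, map_add, mul_add]
    | mk c' g =>
      have hm : liftC₂T h p (C₂T.mk 1 f * C₂T.mk 1 g) = nestedInt J p f * nestedInt J p g := by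
        rw [C₂T.mk_one_mul_mk_one]
        exact constNestedInt_twistedShuffle (θ := lift₂ h p) (e := eps₂) h (deriv_lift₂ h)
          C₂T.eps₂_one_right eps₂_comm (lift₂_eps₂_cons h) f g
      rw [C₂T.mk_mul_mk, liftC₂T_smul, hm, liftC₂T_mk, liftC₂T_mk, map_mul]
      ring

end NestedIntegrals

/-! ## The universal property -/

section UniversalProperty

variable {R : Type*} [CommRing R] {δ : Derivation ℤ R R} {Q : QuasiIntegration δ}
  {S : Type*} [CommRing S] [Algebra (constants δ) S] {d J : S →ₗ[constants δ] S}

/-- The homomorphism `C₁ → S`, `ε(f₀ ⊗ f) ↦ E(f₀ f)`. -/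
def lift₁ (d J : S →ₗ[constants δ] S) (φ : R →ₐ[constants δ] S) (Q : QuasiIntegration δ) :
    C₁ Q →ₐ[constants δ] S :=
  SymmetricAlgebra.lift <| TensorProduct.lift <|
    ((LinearMap.mul (constants δ) S).compl₁₂ (φ.toLinearMap ∘ₗ (RJ Q).subtype)
      (nestedInt J (φ.toLinearMap ∘ₗ (RT Q).subtype))).compr₂ (evaluation d J)

theorem lift₁_eps₁ (φ : R →ₐ[constants δ] S) (q : RJ Q) (f : W Q) :
    lift₁ d J φ Q (eps₁ Q q f) =
      evaluation d J (φ q * nestedInt J (φ.toLinearMap ∘ₗ (RT Q).subtype) f) :=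
  (SymmetricAlgebra.lift_ι_apply _ _).trans (TensorProduct.lift.tmul _ _)

theorem deriv_lift₁ (h : IsIntegroDifferential d J) (φ : R →ₐ[constants δ] S) (c : C₁ Q) :
    d (lift₁ d J φ Q c) = 0 := by
  induction c using C₁.induction with
  | smul_one k => rw [map_smul, map_smul, map_one, h.deriv_one, smul_zero]
  | eps f g => rw [lift₁_eps₁, deriv_evaluation h]
  | mul a b ha hb => rw [map_mul, h.deriv_mul_eq_zero ha hb]
  | add a b ha hb => rw [map_add, map_add, ha, hb, add_zero]

namespace IDR

/-- The map `IDR(R) → S` induced by `φ : R → S`, as a linear map. -/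
def liftLinear (h : IsIntegroDifferential d J) (φ : R →ₐ[constants δ] S)
    (Q : QuasiIntegration δ) : IDR Q →ₗ[constants δ] S :=
  LinearMap.mul' (constants δ) S ∘ₗ TensorProduct.map φ.toLinearMap
    (LinearMap.mul' (constants δ) S ∘ₗ TensorProduct.map (lift₁ d J φ Q).toLinearMap
      (liftC₂T h (φ.toLinearMap ∘ₗ (RT Q).subtype)))

theorem liftLinear_pure (h : IsIntegroDifferential d J) (φ : R →ₐ[constants δ] S) (r : R)
    (c : C₁ Q) (x : C₂T (constants δ) (RT Q)) : liftLinear h φ Q (pure Q r c x) =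
      φ r * (lift₁ d J φ Q c * liftC₂T h (φ.toLinearMap ∘ₗ (RT Q).subtype) x) := rfl

/-- The homomorphism `IDR(R) → S` induced by `φ : R → S`. -/
def liftHom (h : IsIntegroDifferential d J) (φ : R →ₐ[constants δ] S) (Q : QuasiIntegration δ) :
    IDR Q →+* S where
  toFun := liftLinear h φ Q
  map_zero' := map_zero _
  map_add' := map_add _
  map_one' := by
    rw [one_eq_pure, liftLinear_pure, map_one, map_one, liftC₂T_one, mul_one, mul_one]
  map_mul' x y := by
    induction x using induction_pure with
    | zero => rw [zero_mul, map_zero, zero_mul]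
    | add x y hx hy => rw [add_mul, map_add, hx, hy, map_add, add_mul]
    | pure r c x =>
      induction y using induction_pure with
      | zero => rw [mul_zero, map_zero, mul_zero]
      | add x y hx hy => rw [mul_add, map_add, hx, hy, map_add, mul_add]
      | pure s c' y =>
        rw [pure_mul_pure, liftLinear_pure, liftLinear_pure, liftLinear_pure, map_mul, map_mul,
          liftC₂T_mul]
        ring

theorem liftHom_apply (h : IsIntegroDifferential d J) (φ : R →ₐ[constants δ] S) (x : IDR Q) :
    liftHom h φ Q x = liftLinear h φ Q x := rfl

theorem liftHom_ι (h : IsIntegroDifferential d J) (φ : R →ₐ[constants δ] S) (f : R) :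
    liftHom h φ Q (ι Q f) = φ f := by
  rw [liftHom_apply, ι_eq_pure, liftLinear_pure, map_one, liftC₂T_one, mul_one, mul_one]

/-- Separates the three factors for every `c` in `C₁ ⊗ C₂`, so that compatibility with `∂` and `∫`
is checked with a single constant of `S` in place of `c`. -/
theorem liftLinear_tmul (h : IsIntegroDifferential d J) (φ : R →ₐ[constants δ] S) (r : R)
    (c : C₁₂ Q) (f : W Q) : liftLinear h φ Q (tmul Q r c f) =
      φ r * (liftLinear h φ Q (tmul Q 1 c 1) *
        nestedInt J (φ.toLinearMap ∘ₗ (RT Q).subtype) f) := by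
  induction c using TensorProduct.induction_on with
  | zero => rw [tmul_zero_mid, tmul_zero_mid, map_zero, zero_mul, mul_zero]
  | add x y hx hy => rw [tmul_add_mid, tmul_add_mid, map_add, hx, hy, map_add, add_mul, mul_add]
  | tmul c₁ c₂ =>
    rw [tmul_eq_pure, tmul_eq_pure, liftLinear_pure, liftLinear_pure, liftC₂T_mk, liftC₂T_mk,
      map_one, nestedInt_one, one_mul, mul_one, mul_assoc]

theorem deriv_liftLinear_const (h : IsIntegroDifferential d J) (φ : R →ₐ[constants δ] S)
    (c : C₁₂ Q) : d (liftLinear h φ Q (tmul Q 1 c 1)) = 0 := by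
  induction c using TensorProduct.induction_on with
  | zero => rw [tmul_zero_mid, map_zero, map_zero]
  | add x y hx hy => rw [tmul_add_mid, map_add, map_add, hx, hy, add_zero]
  | tmul c₁ c₂ =>
    rw [tmul_eq_pure, liftLinear_pure, liftC₂T_mk, map_one, nestedInt_one, one_mul, mul_one,
      h.deriv_mul_eq_zero (deriv_lift₁ h φ c₁) (deriv_lift₂ h c₂)]

theorem liftLinear_eps₁_mul (h : IsIntegroDifferential d J) (φ : R →ₐ[constants δ] S)
    (q : RJ Q) (f : W Q) (c : C₁₂ Q) :
    liftLinear h φ Q (tmul Q 1 ((eps₁ Q q f ⊗ₜ 1) * c) 1) =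
      liftLinear h φ Q (tmul Q 1 c 1) *
        evaluation d J (φ q * nestedInt J (φ.toLinearMap ∘ₗ (RT Q).subtype) f) := by
  rw [← const_mul_tmul, ← liftHom_apply, map_mul, liftHom_apply, liftHom_apply, tmul_eq_pure,
    liftLinear_pure, liftC₂T_mk, map_one, map_one, nestedInt_one, lift₁_eps₁, one_mul, one_mul,
    mul_one, mul_comm]

section

variable {φ : R →ₐ[constants δ] S} {L : IDR Q →ₗ[constants δ] S} {w : W Q →ₗ[constants δ] S}
  {k : S} {c : C₁₂ Q}

theorem map_deriv_tmul (h : IsIntegroDifferential d J) (hφ : ∀ f, φ (δ f) = d (φ f))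
    (hk : d k = 0) (w_one : w 1 = 1)
    (w_cons : ∀ (a : RT Q) (t : W Q), w (TensorAlgebra.ι _ a * t) = J (φ (a : R) * w t))
    (hL : ∀ r f, L (tmul Q r c f) = φ r * (k * w f)) (r : R) (f : W Q) :
    L (deriv Q (tmul Q r c f)) = d (L (tmul Q r c f)) := by
  induction f using word_induction with
  | one =>
    rw [deriv_tmul_one, hL, hL, w_one, mul_one, h.deriv_mul, hk, mul_zero, add_zero, hφ]
  | add s t hs ht => rw [tmul_add_right, map_add, map_add, hs, ht, map_add, map_add]
  | smul k t ht => rw [tmul_smul_right, map_smul, map_smul, ht, map_smul, map_smul]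
  | cons a t =>
    have hm : φ (r * a) = φ r * φ a := map_mul φ r a
    rw [deriv_tmul_ι_mul, L.map_add, hL, hL, hL, h.deriv_mul, h.deriv_mul, hk, zero_mul,
      zero_add, w_cons, h.deriv_int, hφ, hm]
    ring

set_option maxHeartbeats 1000000 in
-- Under `L`, each term in the recursion for `∫` becomes the matching term of `int_by_parts`, with
-- `q = φ (Q r)`.
theorem map_int_tmul (h : IsIntegroDifferential d J) (hφ : ∀ f, φ (δ f) = d (φ f))
    (hk : d k = 0) (w_one : w 1 = 1)
    (w_cons : ∀ (a : RT Q) (t : W Q), w (TensorAlgebra.ι _ a * t) = J (φ (a : R) * w t))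
    (hL : ∀ r f, L (tmul Q r c f) = φ r * (k * w f))
    (hE : ∀ (q : RJ Q) f, L (tmul Q 1 ((eps₁ Q q f ⊗ₜ 1) * c) 1) =
      k * evaluation d J (φ (q : R) * w f)) (r : R) (f : W Q) :
    L (int Q (tmul Q r c f)) = J (L (tmul Q r c f)) := by
  have hRT : ∀ r t, L (tmul Q 1 c (TensorAlgebra.ι _ (Q.toRT r) * t)) =
      k * J ((φ r - d (φ (Q.toLinearMap r))) * w t) := fun r t => by
    have hr : φ (Q.toRT r : R) = φ r - d (φ (Q.toLinearMap r)) := by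
      rw [← hφ]; exact map_sub φ _ _
    have h1 : φ 1 = 1 := map_one φ
    rw [hL, w_cons, hr, h1, one_mul]
  have hE' : ∀ r f, L (tmul Q 1 ((eps₁ Q (Q.toRJ r) f ⊗ₜ 1) * c) 1) =
      k * evaluation d J (φ (Q.toLinearMap r) * w f) := fun r f => hE _ f
  have hp := fun r f => int_by_parts h hk (φ r) (φ (Q.toLinearMap r)) (w f)
  induction f using word_induction generalizing r with
  | one =>
    have hp := hp r 1
    have hRT := hRT r 1
    -- For the empty word `w = 1` has derivative zero, so integration by parts has no recursive
    -- term.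
    rw [w_one, h.deriv_one, mul_zero, mul_zero, J.map_zero, sub_zero] at hp
    rw [mul_one, w_one] at hRT
    rw [int_tmul_one, L.map_add, L.map_sub, hE', hRT, hL, hL, w_one, hp, mul_left_comm (φ r)]
  | add s t hs ht => rw [tmul_add_right, map_add, map_add, hs, ht, map_add, map_add]
  | smul k t ht => rw [tmul_smul_right, map_smul, map_smul, ht, map_smul, map_smul]
  | cons a t ht =>
    have hp := hp r (TensorAlgebra.ι _ a * t)
    have hd : d (w (TensorAlgebra.ι _ a * t)) = φ a * w t := by rw [w_cons, h.deriv_int]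
    have hm : φ (Q.toLinearMap r * a) = φ (Q.toLinearMap r) * φ a := map_mul φ _ _
    rw [hd] at hp
    rw [int_tmul_ι_mul, L.map_add, L.map_sub, L.map_sub, ht, hE', hRT, hL, hL, hL, hm,
      mul_left_comm (φ r), ← hp, mul_assoc (φ (Q.toLinearMap r)), mul_left_comm (φ a),
      mul_left_comm (φ (Q.toLinearMap r)) k (φ a * w t)]

end

theorem liftHom_deriv (h : IsIntegroDifferential d J) (φ : R →ₐ[constants δ] S)
    (hφ : ∀ f, φ (δ f) = d (φ f)) (x : IDR Q) :
    liftHom h φ Q (deriv Q x) = d (liftHom h φ Q x) := by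
  rw [liftHom_apply, liftHom_apply]
  induction x using induction_tmul with
  | zero => simp only [map_zero]
  | add x y hx hy => simp only [map_add, hx, hy]
  | tmul r c f =>
    exact map_deriv_tmul h hφ (deriv_liftLinear_const h φ c) (nestedInt_one _ _)
      (nestedInt_ι_mul _ _) (fun r f => liftLinear_tmul h φ r c f) r f

theorem liftHom_int (h : IsIntegroDifferential d J) (φ : R →ₐ[constants δ] S)
    (hφ : ∀ f, φ (δ f) = d (φ f)) (x : IDR Q) :
    liftHom h φ Q (int Q x) = J (liftHom h φ Q x) := by
  rw [liftHom_apply, liftHom_apply]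
  induction x using induction_tmul with
  | zero => simp only [map_zero]
  | add x y hx hy => simp only [map_add, hx, hy]
  | tmul r c f =>
    exact map_int_tmul h hφ (deriv_liftLinear_const h φ c) (nestedInt_one _ _)
      (nestedInt_ι_mul _ _) (fun r f => liftLinear_tmul h φ r c f)
      (fun q f => liftLinear_eps₁_mul h φ q f c) r f

end IDR
end UniversalProperty

end IntegroDiff

end

/-! ### Existence and uniqueness of the induced homomorphism, and the main theorem. -/

namespace IntegroDiff.IDR

theorem existsUnique_lift {R : Type*} [CommRing R] {δ : Derivation ℤ R R}
    (Q : QuasiIntegration δ) {S : Type*} [CommRing S] {d J : S → S}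
    (h : IsIntegroDifferential d J) (φ : R →+* S) (hφ : ∀ f : R, φ (δ f) = d (φ f)) :
    ∃! η : IDR Q →+* S, (∀ x, η (deriv Q x) = d (η x)) ∧
      (∀ x, η (int Q x) = J (η x)) ∧ ∀ f : R, η (ι Q f) = φ f := by
  -- `S` becomes an algebra over the constants of `R` through `φ`. Since `φ` sends constants to
  -- constants, `d` and `J` are linear over them.
  let _ : Algebra (constants δ) S := (φ.comp (constants δ).subtype).toAlgebra
  have hc : ∀ c : constants δ, d (φ c) = 0 := fun c => by
    have hc : δ (c : R) = 0 := c.2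
    rw [← hφ, hc, map_zero]
  have hsmul : ∀ (c : constants δ) (x : S), c • x = φ c * x := fun c x => rfl
  let dL : S →ₗ[constants δ] S :=
    { toFun := d
      map_add' := h.deriv_add
      map_smul' := fun c x => by
        rw [hsmul, h.deriv_mul, hc, zero_mul, zero_add, RingHom.id_apply, hsmul] }
  let JL : S →ₗ[constants δ] S :=
    { toFun := J
      map_add' := h.int_add
      map_smul' := fun c x => by rw [hsmul, h.int_const_mul _ _ (hc c), RingHom.id_apply, hsmul] }
  let φL : R →ₐ[constants δ] S := { φ with commutes' := fun c => rfl }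
  have hL : IsIntegroDifferential dL JL := h
  refine ⟨liftHom hL φL Q, ⟨liftHom_deriv hL φL hφ, liftHom_int hL φL hφ, liftHom_ι hL φL⟩, ?_⟩
  rintro η ⟨hηd, hηJ, hηι⟩
  refine RingHom.ext fun x => ?_
  -- Homomorphisms of integro-differential rings that agree on `ι(R)` agree on everything it
  -- generates.
  induction x using induction_generated with
  | hι f => rw [hηι]; exact (liftHom_ι hL φL f).symm
  | hadd x y hx hy => rw [map_add, hx, hy, map_add]
  | hmul x y hx hy => rw [map_mul, hx, hy, map_mul]
  | hd x hx => rw [hηd, hx]; exact (liftHom_deriv hL φL hφ x).symm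
  | hJ x hx => rw [hηJ, hx]; exact (liftHom_int hL φL hφ x).symm

end IntegroDiff.IDR

theorem mainTheorem2 {R : Type*} [CommRing R] (δ : Derivation ℤ R R)
    (Q : IntegroDiff.QuasiIntegration δ) :
    -- `IDR(R)` is a commutative integro-differential ring
    ((∀ x y z : IntegroDiff.IDR Q, x * y * z = x * (y * z)) ∧
      (∀ x y : IntegroDiff.IDR Q, x * y = y * x) ∧
      IntegroDiff.IsIntegroDifferential (IntegroDiff.IDR.deriv Q) (IntegroDiff.IDR.int Q)) ∧
    -- `ι` is an embedding of differential rings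
    (Function.Injective (IntegroDiff.IDR.ι Q) ∧
      ∀ f : R, IntegroDiff.IDR.deriv Q (IntegroDiff.IDR.ι Q f) = IntegroDiff.IDR.ι Q (δ f)) ∧
    -- the universal property
    (∀ (S : Type*) [CommRing S] (d J : S → S), IntegroDiff.IsIntegroDifferential d J →
      ∀ φ : R →+* S, (∀ f : R, φ (δ f) = d (φ f)) →
        ∃! η : IntegroDiff.IDR Q →+* S,
          (∀ x, η (IntegroDiff.IDR.deriv Q x) = d (η x)) ∧
          (∀ x, η (IntegroDiff.IDR.int Q x) = J (η x)) ∧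
          ∀ f : R, η (IntegroDiff.IDR.ι Q f) = φ f) :=
  ⟨⟨IntegroDiff.IDR.mul_assoc Q, IntegroDiff.IDR.mul_comm Q,
      IntegroDiff.IDR.isIntegroDifferential Q⟩,
    ⟨IntegroDiff.IDR.ι_injective Q, IntegroDiff.IDR.deriv_ι Q⟩,
    fun _ _ _ _ h φ hφ => IntegroDiff.IDR.existsUnique_lift Q h φ hφ⟩
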